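/- **Setting.** Let $\boldsymbol\Sigma=(N,\Sigma,\rho)$ be a stacky fan: $N$ is a finitely generated abelian group, $\rho\colon\mathbb Z^n\to N$, $e_i\mapsto\rho_i$, has finite cokernel, and $\Sigma$ is a rational simplicial fan in $N\otimes\mathbb Q$ whose rays are exactly those generated by the images $\bar\rho_1,\dots,\bar\rho_n$; a cone is identified with the set of indices of its rays. Let $S$ be a finite set with $m$ elements and a map $S\to N_\Sigma=\{c\in N:\bar c\in|\Sigma|\}$, with images $s_1,\dots,s_m$. For $c\in N_\Sigma$ write $\bar c=\sum_i c_i\bar\rho_i$ with $c_i\ge 0$, and $c_i=0$ for $i$ outside the minimal cone $\sigma(c)$ containing $\bar c$. Let $\mathrm{Box}(\sigma)$ be the set of $b\in N$ with $\bar b=\sum_{i\in\sigma}b_i\bar\rho_i$, $0\le b_i<1$, let $\mathrm{Box}(\boldsymbol\Sigma)=\bigcup_\sigma\mathrm{Box}(\sigma)$, and let $\hat b=\sum_i\lceil b_i\rceil\rho_i-b$. Write $\langle x\rangle$ for the fractional part of $x$. Let $R_{\mathbb T}=\mathrm{Sym}_{\mathbb C}(N^*\otimes\mathbb C)$, $S_{\mathbb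 T}=\mathrm{Frac}(R_{\mathbb T})$, $S_{\mathbb T\times\mathbb C^\times}=S_{\mathbb T}(z)$, and $$H_{\mathrm{CR},\mathbb T}=R_{\mathbb T}[N_\Sigma]\big/\big(\chi-\textstyle\sum_{i=1}^n\chi(\rho_i)y^{\rho_i}:\chi\in N^*\otimes\mathbb C\big),$$ where $y^{c}y^{c'}=y^{c+c'}$ if $\bar c,\bar c'$ lie in a common cone and $y^cy^{c'}=0$ otherwise. Put $u_i=y^{\rho_i}$ for $i\le n$ and $u_i=0$ for $n<i\le n+m$. Let $\mathbb L=\ker\rho$ and let $\mathbb L^S$ be the kernel of $\rho^S\colon\mathbb Z^{n+m}\to N$, $e_i\mapsto\rho_i$ for $i\le n$, $e_{n+l}\mapsto s_l$. Write $\lambda\in\mathbb L^S\otimes\mathbb Q$ as $\lambda=(d,k)$ under $\mathbb L^S\otimes\mathbb Q\cong(\mathbb L\otimes\mathbb Q)\oplus\mathbb Q^m$, where $k_l=\lambda_{n+l}$ and $d_i=\lambda_i+\sum_l k_l(s_l)_i$; put $D_i\cdot d=d_i$. Let $\Lambda^S$ be the set of $\lambda\in\mathbb L^S\otimes\mathbb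 Q$ with $\lambda_{n+l}\in\mathbb Z$ for all $l$ such that, for some $\sigma\in\Sigma$, $\lambda_i\in\mathbb Z$ for all $i\le n$, $i\notin\sigma$. Let $v^S(\lambda)=\sum_{i\le n}\lceil\lambda_i\rceil\rho_i+\sum_l\lceil\lambda_{n+l}\rceil s_l$. Let $\mathrm{NE}=\sum_{\sigma\in\Sigma}\{d\in\mathbb L\otimes\mathbb Q: d_i\ge0\text{ for all }i\notin\sigma\}$, $\mathrm{NE}^S=\{(d,k):d\in\mathrm{NE},\,k\ge0\}$ and $\Lambda E^S_b=\{\lambda\in\Lambda^S:v^S(\lambda)=b\}\cap\mathrm{NE}^S$. The $S$-extended $\mathbb T$-equivariant $I$-function is the formal series in $Q$, $x_1,\dots,x_m$, $t_1,\dots,t_n$ with coefficients in $H_{\mathrm{CR},\mathbb T}\otimes_{R_{\mathbb T}}S_{\mathbb T\times\mathbb C^\times}$ $$I^S=z\,e^{\sum_{i=1}^n u_it_i/z}\sum_{b\in\mathrm{Box}(\boldsymbol\Sigma)}\ \sum_{\lambda=(d,k)\in\Lambda E^S_b}Q^dx^k\,e^{\sum_i(D_i\cdot d)t_i}\left(\prod_{i=1}^{n+m}\frac{\prod_{\langle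 a\rangle=\langle\lambda_i\rangle,\,a\le0}(u_i+az)}{\prod_{\langle a\rangle=\langle\lambda_i\rangle,\,a\le\lambda_i}(u_i+az)}\right)y^b .$$ For a top-dimensional cone $\sigma$, let $u_i(\sigma)\in N^*\otimes\mathbb Q$ be the element of the basis dual to $(\bar\rho_k)_{k\in\sigma}$ that belongs to $i$ if $i\in\sigma$, and $u_i(\sigma)=0$ if $i\notin\sigma$. For $b\in\mathrm{Box}(\sigma)$ let $I^S_{(\sigma,b)}$ be the restriction of $I^S$ to the component of the inertia stack of the torus-fixed point of $\sigma$ labelled by $b$, i.e. the result of applying to all coefficients the $S_{\mathbb T\times\mathbb C^\times}$-linear map with $y^{c}\mapsto\prod_{i\in\sigma}u_i(\sigma)^{k_i}$ if $\bar c\in\sigma$ and $c=b+\sum_{i\in\sigma}k_i\rho_i$ with $k_i\in\mathbb Z_{\ge0}$, and $y^c\mapsto0$ for all other $c$. Let $\sigma,\sigma'$ be top-dimensional cones that meet along a codimension-one face, $\sigma\setminus\sigma'=\{j\}$ and $\sigma'\setminus\sigma=\{j'\}$. Let $b\in\mathrm{Box}(\sigma)$ and let $c>0$ be a rational number with $\langle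 c\rangle=\hat b_j$. Let $l=l(c,\sigma,j)\in\mathbb L\otimes\mathbb Q$ be given by the unique relation $c\bar\rho_j+\sum_{i\in\sigma\cap\sigma'}c_i\bar\rho_i+c'\bar\rho_{j'}=0$, and put $$\mathrm{RC}(c)_{(\sigma,b)}^{(\sigma',b')}=\frac1c\Big(\prod_{i\in\sigma:\,b_i=0}u_i(\sigma)\Big)\frac{\big(\frac{c}{u_j(\sigma)}\big)^{\lfloor c\rfloor}}{\lfloor c\rfloor!}\,\frac{\big(-\frac{c}{u_j(\sigma)}\big)^{\lfloor c'\rfloor}}{\lfloor c'\rfloor!}\prod_{i\in\sigma\cap\sigma'}\frac{\prod_{\langle a\rangle=\hat b_i,\,a<0}\big(u_i(\sigma)-\frac ac u_j(\sigma)\big)}{\prod_{\langle a\rangle=\hat b_i,\,a\le c_i}\big(u_i(\sigma)-\frac ac u_j(\sigma)\big)}\in S_{\mathbb T}.$$ (Quotients of infinite products are understood after cancelling common factors.) **Proposition.** There is a unique $b'\in\mathrm{Box}(\sigma')$ such that $$\hat b+\lfloor c\rfloor\rho_j+q'\rho_{j'}+b'\in\sum_{i\in\sigma\cap\sigma'}\mathbb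 Z\rho_i\quad\text{for some }q'\in\mathbb Z_{\ge0}.$$ For this $b'$, every coefficient of the series $I^S_{(\sigma',b')}$ is a rational function of $z$ over $S_{\mathbb T}$ that is regular at $z=-u_j(\sigma)/c$, and, coefficientwise in $Q,x,t$, $$\operatorname{Res}_{z=-\frac{u_j(\sigma)}c}I^S_{(\sigma,b)}(z)\,dz=Q^{l(c,\sigma,j)}\;\mathrm{RC}(c)_{(\sigma,b)}^{(\sigma',b')}\;I^S_{(\sigma',b')}(z)\Big|_{z=-\frac{u_j(\sigma)}c}.$$ -/

import Mathlib

open scoped TensorProduct Classical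

noncomputable section

namespace ToricStack

/-! ### Stacky fans -/

/-- The rational vector space `N_ℚ = ℚ ⊗ N`. -/
abbrev NQ (N : Type*) [AddCommGroup N] : Type _ := ℚ ⊗[ℤ] N

/-- The image `c̄` of `c ∈ N` in `N_ℚ`. -/
def bar {N : Type*} [AddCommGroup N] (c : N) : NQ N := (1 : ℚ) ⊗ₜ[ℤ] c

/-- The cone spanned by the vectors `v i`, `i ∈ σ`. -/
def coneOf {V : Type*} [AddCommGroup V] [Module ℚ V] {n : ℕ} (v : Fin n → V)
    (σ : Finset (Fin n)) : Set V :=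
  {x | ∃ a : Fin n → ℚ, (∀ i, 0 ≤ a i) ∧ (∀ i, i ∉ σ → a i = 0) ∧ x = ∑ i, a i • v i}

/-- A stacky fan `(N, Σ, ρ)`: a homomorphism `ρ : ℤⁿ → N` (given by the images `ρ i` of the standard
basis vectors) with finite cokernel, and a rational simplicial fan `Σ` in `N_ℚ` whose rays are
exactly those generated by the `ρ̄ i`.  A cone is identified with the set of the indices of its
rays. -/
structure StackyFan (N : Type*) [AddCommGroup N] (n : ℕ) where
  ρ : Fin n → N
  cones : Set (Finset (Fin n))
  finite_coker : Finite (N ⧸ AddSubgroup.closure (Set.range ρ))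
  empty_mem : ∅ ∈ cones
  ray_mem : ∀ i, {i} ∈ cones
  face_mem : ∀ σ ∈ cones, ∀ τ, τ ⊆ σ → τ ∈ cones
  simplicial : ∀ σ ∈ cones, LinearIndependent ℚ (fun i : σ => bar (ρ i))
  inter_face : ∀ σ ∈ cones, ∀ τ ∈ cones,
    coneOf (fun i => bar (ρ i)) σ ∩ coneOf (fun i => bar (ρ i)) τ
      = coneOf (fun i => bar (ρ i)) (σ ∩ τ)

/-! ### The coefficient rings -/

/-- `R_𝕋 = H_𝕋(pt) = Sym_ℂ(N^* ⊗ ℂ)`; here `N^* ⊗ ℚ` is the dual space of `N_ℚ`. -/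
abbrev RT (N : Type*) [AddCommGroup N] : Type _ :=
  SymmetricAlgebra ℂ (ℂ ⊗[ℚ] Module.Dual ℚ (NQ N))

/-- `S_𝕋 = Frac(R_𝕋)`. -/
def ST (N : Type*) [AddCommGroup N] : Type _ := FractionRing (RT N)

instance (N : Type*) [AddCommGroup N] : Field (ST N) :=
  inferInstanceAs (Field (FractionRing (RT N)))

instance (N : Type*) [AddCommGroup N] : Algebra (RT N) (ST N) :=
  inferInstanceAs (Algebra (RT N) (FractionRing (RT N)))

instance (N : Type*) [AddCommGroup N] : IsFractionRing (RT N) (ST N) :=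
  inferInstanceAs (IsFractionRing (RT N) (FractionRing (RT N)))

instance (N : Type*) [AddCommGroup N] : CharZero (ST N) :=
  charZero_of_injective_ringHom (f := (algebraMap (RT N) (ST N)).comp (algebraMap ℂ (RT N)))
    ((IsFractionRing.injective (RT N) (ST N)).comp (algebraMap ℂ (RT N)).injective)

/-- `S_{𝕋 × ℂ^×} = S_𝕋(z)`. -/
abbrev STz (N : Type*) [AddCommGroup N] : Type _ := RatFunc (ST N)

/-- A rational character `χ ∈ N^* ⊗ ℚ` as an element of `S_𝕋`. -/
def charST {N : Type*} [AddCommGroup N] : Module.Dual ℚ (NQ N) →+ ST N where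
  toFun χ := algebraMap (RT N) (ST N)
    (SymmetricAlgebra.ι ℂ (ℂ ⊗[ℚ] Module.Dual ℚ (NQ N)) ((1 : ℂ) ⊗ₜ[ℚ] χ))
  map_zero' := by rw [TensorProduct.tmul_zero, map_zero, map_zero]
  map_add' x y := by rw [TensorProduct.tmul_add, map_add, map_add]

theorem charST_smul {N : Type*} [AddCommGroup N] (q : ℚ) (χ : Module.Dual ℚ (NQ N)) :
    charST (q • χ) = (q : ST N) * charST χ := by
  rw [map_rat_smul (charST (N := N)), Algebra.smul_def, eq_ratCast]

/-- The quotient `∏_{a ∈ A} f a / ∏_{a ∈ B} f a` of two products that may be infinite, understood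
by cancelling the common factors. It is used where `A \ B` and `B \ A` are finite and the remaining
denominator is a unit. -/
def prodQuot {R : Type*} [CommRing R] (A B : Set ℚ) (f : ℚ → R) : R :=
  (∏ᶠ a ∈ A \ B, f a) * Ring.inverse (∏ᶠ a ∈ B \ A, f a)

/-- The factor `∏_{⟨a⟩ = ⟨x⟩, a ≤ 0} (u + a z) / ∏_{⟨a⟩ = ⟨x⟩, a ≤ x} (u + a z)` in an algebra
over a field that contains `z`. -/
def hyperFactor {K R : Type*} [Field K] [CommRing R] [Algebra K R] (u : R) (z : K) (x : ℚ) : R :=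
  prodQuot {a | Int.fract a = Int.fract x ∧ a ≤ 0} {a | Int.fract a = Int.fract x ∧ a ≤ x}
    (fun a => u + algebraMap K R ((a : K) * z))

/-- The power series `exp (∑ i, w i * t i)` in the variables `t i`, over an algebra over a field
`K` of characteristic zero. -/
def expT (K : Type*) {R : Type*} [Field K] [CommRing R] [Algebra K R] {n : ℕ} (w : Fin n → R) :
    MvPowerSeries (Fin n) R :=
  fun e => ∏ i, algebraMap K R ((Nat.factorial (e i) : K)⁻¹) * w i ^ e i

namespace StackyFan

variable {N : Type*} [AddCommGroup N] {n : ℕ} (F : StackyFan N n)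

/-- The image `ρ̄ i` of `ρ i` in `N_ℚ`. -/
def ray (i : Fin n) : NQ N := bar (F.ρ i)

/-- The cone `σ` as a subset of `N_ℚ`. -/
def cone (σ : Finset (Fin n)) : Set (NQ N) := coneOf F.ray σ

/-- `N_Σ`: the elements `c ∈ N` with `c̄` in the support of the fan. -/
def suppSet : Set N := {c | ∃ σ ∈ F.cones, bar c ∈ F.cone σ}

/-- `c̄₁` and `c̄₂` lie in a common cone of the fan. -/
def CommonCone (c₁ c₂ : N) : Prop := ∃ σ ∈ F.cones, bar c₁ ∈ F.cone σ ∧ bar c₂ ∈ F.cone σ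

/-- For `c ∈ N_Σ`, the unique nonnegative numbers `a i`, vanishing outside a cone, with
`c̄ = ∑ a i ρ̄ i`.  For a box element `b` these are the numbers `b_i`. -/
def coord (c : N) : Fin n → ℚ :=
  if h : ∃ a : Fin n → ℚ, (∀ i, 0 ≤ a i) ∧ (∃ σ ∈ F.cones, ∀ i, i ∉ σ → a i = 0) ∧
      bar c = ∑ i, a i • F.ray i then h.choose else 0

/-- `Box(σ)`. -/
def boxOf (σ : Finset (Fin n)) : Set N :=
  {b | ∃ a : Fin n → ℚ, (∀ i, 0 ≤ a i ∧ a i < 1) ∧ (∀ i, i ∉ σ → a i = 0) ∧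
    bar b = ∑ i, a i • F.ray i}

/-- `Box(Σ)`. -/
def box : Set N := {b | ∃ σ ∈ F.cones, b ∈ F.boxOf σ}

/-- The involution `b ↦ b̂` on the box: `b̂` is the box element of the minimal cone `σ(b)` of `b̄`
which is inverse to `b` modulo `∑_{i ∈ σ(b)} ℤ ρ i`. -/
def hat (b : N) : N := (∑ i, ⌈F.coord b i⌉ • F.ρ i) - b

/-- `N_σ = ∑_{i ∈ σ} ℤ ρ i`. -/
def sublattice (σ : Finset (Fin n)) : AddSubgroup N :=
  AddSubgroup.closure (F.ρ '' (σ : Set (Fin n)))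

/-- `σ` is a top-dimensional cone of the fan. -/
def IsTop (σ : Finset (Fin n)) : Prop :=
  σ ∈ F.cones ∧ Submodule.span ℚ (F.ray '' (σ : Set (Fin n))) = ⊤

/-- `σ | σ'`: top-dimensional cones that meet along a face of codimension one; `j` is the index in
`σ` but not in `σ'`, and `j'` the index in `σ'` but not in `σ`. -/
structure Adjacent (σ σ' : Finset (Fin n)) (j j' : Fin n) : Prop where
  left : F.IsTop σ
  right : F.IsTop σ'
  left_diff : σ \ σ' = {j}
  right_diff : σ' \ σ = {j'}

/-! ### Weights at the fixed points -/

/-- The weight `u_i(σ) ∈ N^* ⊗ ℚ` of `u_i` at the fixed point of a top-dimensional cone `σ`: the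
`ρ̄ k`, `k ∈ σ`, form a basis of `N_ℚ`; `u_i(σ)` is the element of the dual basis that
belongs to `i` if `i ∈ σ`, and zero if `i ∉ σ`. -/
def weight (σ : Finset (Fin n)) (i : Fin n) : Module.Dual ℚ (NQ N) :=
  if h : ∃ φ : Module.Dual ℚ (NQ N), ∀ k ∈ σ, φ (F.ray k) = if k = i then 1 else 0
  then h.choose else 0

/-- `u_i(σ)` as an element of `S_𝕋`. -/
def u (σ : Finset (Fin n)) (i : Fin n) : ST N := charST (F.weight σ i)

/-! ### Chen-Ruan cohomology -/

/-- The relations between the generators `y^c`, `c ∈ N`, of the localized equivariant Chen-Ruan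
cohomology ring: `y^c = 0` for `c ∉ N_Σ`; the multiplication table of `R_𝕋[N_Σ]`; and
`χ = ∑ χ(ρ i) y^{ρ i}` for the characters `χ`. -/
inductive CRRel : MvPolynomial N (STz N) → Prop
  | outside (c : N) (h : c ∉ F.suppSet) : CRRel (MvPolynomial.X c)
  | one : CRRel (MvPolynomial.X 0 - 1)
  | mul (c₁ c₂ : N) (h : F.CommonCone c₁ c₂) :
      CRRel (MvPolynomial.X c₁ * MvPolynomial.X c₂ - MvPolynomial.X (c₁ + c₂))
  | mul_zero (c₁ c₂ : N) (h : ¬ F.CommonCone c₁ c₂) :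
      CRRel (MvPolynomial.X c₁ * MvPolynomial.X c₂)
  | linear (χ : Module.Dual ℚ (NQ N)) :
      CRRel (MvPolynomial.C (RatFunc.C (charST χ))
        - ∑ i, MvPolynomial.C ((χ (F.ray i) : ℚ) : STz N) * MvPolynomial.X (F.ρ i))

/-- The ideal of relations. -/
def crIdeal : Ideal (MvPolynomial N (STz N)) := Ideal.span {p | F.CRRel p}

/-- The localized equivariant Chen-Ruan cohomology ring `H_{CR,𝕋}(𝒳) ⊗_{R_𝕋} S_{𝕋 × ℂ^×}`, where
`H_{CR,𝕋}(𝒳) = R_𝕋[N_Σ] / (χ - ∑ χ(ρ i) y^{ρ i})`. -/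
def CR : Type _ := MvPolynomial N (STz N) ⧸ F.crIdeal

instance : CommRing F.CR := inferInstanceAs (CommRing (MvPolynomial N (STz N) ⧸ F.crIdeal))

instance : Algebra (STz N) F.CR :=
  inferInstanceAs (Algebra (STz N) (MvPolynomial N (STz N) ⧸ F.crIdeal))

/-- The class `y^c`.  For a box element `b` it is the unit class of the twisted sector of `b`, and
`y^{ρ i}` is the class `u_i`. -/
def y (c : N) : F.CR := Ideal.Quotient.mk F.crIdeal (MvPolynomial.X c)

/-- The homomorphism sending `y^c` to the monomial `c` if `c̄ ∈ σ` and to zero otherwise. -/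
def chart (σ : Finset (Fin n)) :
    MvPolynomial N (STz N) →ₐ[STz N] AddMonoidAlgebra (STz N) N :=
  MvPolynomial.aeval (fun c => if bar c ∈ F.cone σ then AddMonoidAlgebra.single c 1 else 0)

/-- The linear map sending the monomial `b + ∑_{i ∈ σ} k i • ρ i` to `∏_{i ∈ σ} u_i(σ) ^ k i`, and
the monomials outside `b + N_σ` to zero.  Here `b ∈ Box(σ)`, so that `k i` is the integral part of
the `i`-th coordinate. -/
def component (σ : Finset (Fin n)) (b : N) : AddMonoidAlgebra (STz N) N →ₗ[STz N] STz N :=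
  Finsupp.linearCombination (STz N) (fun c : N =>
    if c - b ∈ F.sublattice σ then
      ∏ i ∈ σ, RatFunc.C (F.u σ i) ^ ⌊F.weight σ i (bar c)⌋ else 0)
  ∘ₗ (AddMonoidAlgebra.coeffLinearEquiv (STz N)).toLinearMap

theorem charST_ne_zero {χ : Module.Dual ℚ (NQ N)} (h : χ ≠ 0) : charST χ ≠ 0 := by
  have h1 : (1 : ℂ) ⊗ₜ[ℚ] χ ≠ 0 := by
    intro h0
    apply h
    apply Module.FaithfullyFlat.tensorProduct_mk_injective (A := ℚ) (B := ℂ)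
      (Module.Dual ℚ (NQ N))
    rw [map_zero]
    exact h0
  have h2 : ∃ f : Module.Dual ℂ (ℂ ⊗[ℚ] Module.Dual ℚ (NQ N)), f ((1 : ℂ) ⊗ₜ[ℚ] χ) ≠ 0 := by
    by_contra hc
    push Not at hc
    exact h1 ((Module.forall_dual_apply_eq_zero_iff ℂ _).1 hc)
  obtain ⟨f, hf⟩ := h2
  intro h0
  apply hf
  have h3 : SymmetricAlgebra.ι ℂ (ℂ ⊗[ℚ] Module.Dual ℚ (NQ N)) ((1 : ℂ) ⊗ₜ[ℚ] χ) = 0 := by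
    apply IsFractionRing.injective (RT N) (ST N)
    rw [map_zero]
    exact h0
  rw [← SymmetricAlgebra.lift_ι_apply f, h3, map_zero]

section
variable {F} {σ : Finset (Fin n)}

theorem IsTop.exists_weight (hσ : F.IsTop σ) (i : Fin n) :
    ∃ φ : Module.Dual ℚ (NQ N), ∀ k ∈ σ, φ (F.ray k) = if k = i then 1 else 0 := by
  have hli : LinearIndependent ℚ (fun k : σ => F.ray k) := F.simplicial σ hσ.1
  have hsp : ⊤ ≤ Submodule.span ℚ (Set.range (fun k : σ => F.ray k)) := by
    rw [← hσ.2]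
    apply Submodule.span_mono
    rintro _ ⟨k, hk, rfl⟩
    exact ⟨⟨k, hk⟩, rfl⟩
  refine ⟨(Module.Basis.mk hli hsp).constr ℚ (fun k : σ => if (k : Fin n) = i then 1 else 0), ?_⟩
  intro k hk
  have := (Module.Basis.mk hli hsp).constr_basis ℚ
    (fun k : σ => if (k : Fin n) = i then (1 : ℚ) else 0) ⟨k, hk⟩
  rwa [Module.Basis.mk_apply] at this

theorem IsTop.weight_ray (hσ : F.IsTop σ) (i : Fin n) {k : Fin n} (hk : k ∈ σ) :
    F.weight σ i (F.ray k) = if k = i then 1 else 0 := by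
  rw [weight, dif_pos (hσ.exists_weight i)]
  exact (hσ.exists_weight i).choose_spec k hk

theorem IsTop.dual_ext (hσ : F.IsTop σ) {φ ψ : Module.Dual ℚ (NQ N)}
    (h : ∀ k ∈ σ, φ (F.ray k) = ψ (F.ray k)) : φ = ψ := by
  apply LinearMap.ext_on hσ.2
  rintro _ ⟨k, hk, rfl⟩
  exact h k hk

theorem IsTop.charST_eq (hσ : F.IsTop σ) (χ : Module.Dual ℚ (NQ N)) :
    charST χ = ∑ i ∈ σ, (χ (F.ray i) : ST N) * F.u σ i := by
  have h : χ = ∑ i ∈ σ, χ (F.ray i) • F.weight σ i := by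
    apply hσ.dual_ext
    intro k hk
    rw [LinearMap.sum_apply]
    simp only [LinearMap.smul_apply, hσ.weight_ray _ hk, smul_eq_mul, mul_ite, mul_one, mul_zero]
    rw [Finset.sum_ite_eq σ k, if_pos hk]
  conv_lhs => rw [h]
  rw [map_sum]
  exact Finset.sum_congr rfl fun i _ => charST_smul _ _

theorem IsTop.u_ne_zero (hσ : F.IsTop σ) {i : Fin n} (hi : i ∈ σ) : F.u σ i ≠ 0 := by
  apply charST_ne_zero
  intro h
  have := hσ.weight_ray i hi
  rw [h] at this
  simp at this

theorem mem_cone_of_add_mem (hσ : σ ∈ F.cones) {c₁ c₂ : N} (h : F.CommonCone c₁ c₂)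
    (hc : bar (c₁ + c₂) ∈ F.cone σ) : bar c₁ ∈ F.cone σ ∧ bar c₂ ∈ F.cone σ := by
  obtain ⟨τ, hτ, ⟨a₁, h₁, z₁, e₁⟩, ⟨a₂, h₂, z₂, e₂⟩⟩ := h
  have hs : bar (c₁ + c₂) = ∑ i, (a₁ i + a₂ i) • F.ray i := by
    simp only [add_smul, Finset.sum_add_distrib, ← e₁, ← e₂]
    simp [bar, TensorProduct.tmul_add]
  have hτ' : bar (c₁ + c₂) ∈ F.cone τ :=
    ⟨fun i => a₁ i + a₂ i, fun i => add_nonneg (h₁ i) (h₂ i),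
      fun i hi => by simp [z₁ i hi, z₂ i hi], hs⟩
  have hm : bar (c₁ + c₂) ∈ F.cone (σ ∩ τ) := by
    have := F.inter_face σ hσ τ hτ
    exact (Set.ext_iff.1 this _).1 ⟨hc, hτ'⟩
  obtain ⟨e, -, ze, he⟩ := hm
  have key : ∀ i, a₁ i + a₂ i = e i := by
    have h0 : ∑ i ∈ τ, (a₁ i + a₂ i - e i) • F.ray i = 0 := by
      rw [Finset.sum_subset (Finset.subset_univ τ)]
      · simp only [sub_smul, Finset.sum_sub_distrib, ← hs, ← he, sub_self]
      · intro i _ hi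
        rw [z₁ i hi, z₂ i hi, ze i (fun h => hi (Finset.mem_inter.1 h).2)]
        simp
    have hli : LinearIndepOn ℚ F.ray (τ : Set (Fin n)) := F.simplicial τ hτ
    intro i
    by_cases hi : i ∈ τ
    · exact sub_eq_zero.1 (linearIndepOn_finset_iff.1 hli _ h0 i hi)
    · rw [z₁ i hi, z₂ i hi, ze i (fun h => hi (Finset.mem_inter.1 h).2), add_zero]
  have hz : ∀ i, i ∉ σ → a₁ i = 0 ∧ a₂ i = 0 := by
    intro i hi
    have h0 := key i
    rw [ze i (fun h => hi (Finset.mem_inter.1 h).1)] at h0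
    constructor <;> linarith [h₁ i, h₂ i]
  exact ⟨⟨a₁, h₁, fun i hi => (hz i hi).1, e₁⟩, ⟨a₂, h₂, fun i hi => (hz i hi).2, e₂⟩⟩

theorem ray_mem_cone_iff (hσ : σ ∈ F.cones) (i : Fin n) : F.ray i ∈ F.cone σ ↔ i ∈ σ := by
  have hsing : ∀ τ : Finset (Fin n), i ∈ τ → F.ray i ∈ F.cone τ := fun τ hi =>
    ⟨fun k => if k = i then 1 else 0, fun k => by dsimp only; split_ifs <;> simp,
      fun k hk => if_neg (fun h : k = i => hk (h.symm ▸ hi)), by simp⟩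
  refine ⟨fun h => ?_, hsing σ⟩
  by_contra hi
  have hm : F.ray i ∈ F.cone (σ ∩ {i}) :=
    (Set.ext_iff.1 (F.inter_face σ hσ {i} (F.ray_mem i)) _).1 ⟨h, hsing {i} (by simp)⟩
  rw [Finset.inter_singleton_of_notMem hi] at hm
  obtain ⟨e, -, ze, he⟩ := hm
  have h0 : F.ray i = 0 := by
    rw [he]
    exact Finset.sum_eq_zero fun k _ => by rw [ze k (by simp), zero_smul]
  exact (F.simplicial {i} (F.ray_mem i)).ne_zero (⟨i, by simp⟩ : ({i} : Finset (Fin n))) h0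

theorem component_single (b c : N) (x : STz N) :
    F.component σ b (AddMonoidAlgebra.single c x) = x *
      (if c - b ∈ F.sublattice σ then
        ∏ i ∈ σ, RatFunc.C (F.u σ i) ^ ⌊F.weight σ i (bar c)⌋ else 0) := by
  have h : AddMonoidAlgebra.coeffLinearEquiv (STz N) (AddMonoidAlgebra.single c x)
      = Finsupp.single c x := rfl
  rw [component, LinearMap.comp_apply, LinearEquiv.coe_coe, h,
    Finsupp.linearCombination_single, smul_eq_mul]

theorem IsTop.component_shift (hσ : F.IsTop σ) (b c : N) {i : Fin n} (hi : i ∈ σ) (x : STz N) :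
    F.component σ b (AddMonoidAlgebra.single (c + F.ρ i) x)
      = RatFunc.C (F.u σ i) * F.component σ b (AddMonoidAlgebra.single c x) := by
  have hmem : (c + F.ρ i - b ∈ F.sublattice σ) ↔ (c - b ∈ F.sublattice σ) := by
    have hr : F.ρ i ∈ F.sublattice σ := AddSubgroup.subset_closure ⟨i, hi, rfl⟩
    rw [add_sub_right_comm]
    exact AddSubgroup.add_mem_cancel_right _ hr
  rw [component_single, component_single]
  simp only [hmem]
  split_ifs
  · have hb : bar (c + F.ρ i) = bar c + F.ray i := by simp [bar, ray, TensorProduct.tmul_add]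
    have hne : (RatFunc.C (F.u σ i) : STz N) ≠ 0 := by
      rw [Ne, map_eq_zero]
      exact hσ.u_ne_zero hi
    have : ∏ k ∈ σ, (RatFunc.C (F.u σ k) : STz N) ^ ⌊F.weight σ k (bar (c + F.ρ i))⌋
        = RatFunc.C (F.u σ i) * ∏ k ∈ σ, RatFunc.C (F.u σ k) ^ ⌊F.weight σ k (bar c)⌋ := by
      rw [← Finset.mul_prod_erase σ _ hi, ← Finset.mul_prod_erase σ _ hi, ← mul_assoc]
      congr 1
      · rw [hb, map_add, hσ.weight_ray i hi, if_pos rfl, Int.floor_add_one, zpow_add_one₀ hne,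
          mul_comm]
      · refine Finset.prod_congr rfl fun k hk => ?_
        rw [hb, map_add, hσ.weight_ray k hi, if_neg (Finset.ne_of_mem_erase hk).symm, add_zero]
    rw [this]
    ring
  · simp

theorem IsTop.component_chart_eq_zero (hσ : F.IsTop σ) (b : N) {p : MvPolynomial N (STz N)}
    (hp : p ∈ F.crIdeal) : F.component σ b (F.chart σ p) = 0 := by
  have hgen : ∀ q, F.CRRel q → ∀ f : AddMonoidAlgebra (STz N) N,
      F.component σ b (f * F.chart σ q) = 0 := by
    intro q hq
    cases hq with
    | outside c h =>
      intro f
      have : F.chart σ (MvPolynomial.X c) = 0 := by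
        rw [chart, MvPolynomial.aeval_X, if_neg fun hc => h ⟨σ, hσ.1, hc⟩]
      rw [this, MulZeroClass.mul_zero, map_zero]
    | one =>
      intro f
      have h0 : bar (0 : N) ∈ F.cone σ :=
        ⟨0, fun _ => le_rfl, fun _ _ => rfl, by simp [bar]⟩
      have : F.chart σ (MvPolynomial.X 0 - 1) = 0 := by
        rw [map_sub, map_one, chart, MvPolynomial.aeval_X, if_pos h0, sub_eq_zero]
        rfl
      rw [this, MulZeroClass.mul_zero, map_zero]
    | mul c₁ c₂ h =>
      intro f
      have : F.chart σ (MvPolynomial.X c₁ * MvPolynomial.X c₂ - MvPolynomial.X (c₁ + c₂)) = 0 := by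
        rw [map_sub, map_mul, chart, MvPolynomial.aeval_X, MvPolynomial.aeval_X,
          MvPolynomial.aeval_X, sub_eq_zero]
        by_cases hc : bar (c₁ + c₂) ∈ F.cone σ
        · obtain ⟨h1, h2⟩ := mem_cone_of_add_mem hσ.1 h hc
          rw [if_pos h1, if_pos h2, if_pos hc, AddMonoidAlgebra.single_mul_single, one_mul]
        · rw [if_neg hc]
          by_cases h1 : bar c₁ ∈ F.cone σ
          · by_cases h2 : bar c₂ ∈ F.cone σ
            · exfalso
              apply hc
              obtain ⟨a₁, p₁, z₁, e₁⟩ := h1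
              obtain ⟨a₂, p₂, z₂, e₂⟩ := h2
              refine ⟨fun i => a₁ i + a₂ i, fun i => add_nonneg (p₁ i) (p₂ i),
                fun i hi => by simp [z₁ i hi, z₂ i hi], ?_⟩
              simp only [add_smul, Finset.sum_add_distrib, ← e₁, ← e₂]
              simp [bar, TensorProduct.tmul_add]
            · rw [if_neg h2, MulZeroClass.mul_zero]
          · rw [if_neg h1, MulZeroClass.zero_mul]
      rw [this, MulZeroClass.mul_zero, map_zero]
    | mul_zero c₁ c₂ h =>
      intro f
      have : F.chart σ (MvPolynomial.X c₁ * MvPolynomial.X c₂) = 0 := by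
        rw [map_mul, chart, MvPolynomial.aeval_X, MvPolynomial.aeval_X]
        by_cases h1 : bar c₁ ∈ F.cone σ
        · rw [if_neg fun h2 => h ⟨σ, hσ.1, h1, h2⟩, MulZeroClass.mul_zero]
        · rw [if_neg h1, MulZeroClass.zero_mul]
      rw [this, MulZeroClass.mul_zero, map_zero]
    | linear χ =>
      have hg : F.chart σ (MvPolynomial.C (RatFunc.C (charST χ))
          - ∑ i, MvPolynomial.C ((χ (F.ray i) : ℚ) : STz N) * MvPolynomial.X (F.ρ i))
          = AddMonoidAlgebra.single 0 (RatFunc.C (charST χ))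
            - ∑ i ∈ σ, AddMonoidAlgebra.single (F.ρ i) ((χ (F.ray i) : ℚ) : STz N) := by
        rw [map_sub, map_sum, ← Finset.sum_subset (Finset.subset_univ σ)]
        · congr 1
          · simp only [chart, MvPolynomial.aeval_C]
            rfl
          · refine Finset.sum_congr rfl fun i hi => ?_
            have : bar (F.ρ i) ∈ F.cone σ := (ray_mem_cone_iff hσ.1 i).2 hi
            simp only [chart, map_mul, MvPolynomial.aeval_C, MvPolynomial.aeval_X, if_pos this]
            rw [← Algebra.smul_def, AddMonoidAlgebra.smul_single, smul_eq_mul, mul_one]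
        · intro i _ hi
          have : bar (F.ρ i) ∉ F.cone σ := fun h => hi ((ray_mem_cone_iff hσ.1 i).1 h)
          simp only [chart, map_mul, MvPolynomial.aeval_X, if_neg this, MulZeroClass.mul_zero]
      rw [hg]
      intro f
      induction f using AddMonoidAlgebra.induction_linear with
      | zero => rw [MulZeroClass.zero_mul, map_zero]
      | add f g hf hg => rw [_root_.add_mul, map_add, hf, hg, add_zero]
      | single c x =>
        rw [mul_sub, Finset.mul_sum, map_sub, map_sum, AddMonoidAlgebra.single_mul_single, add_zero]
        have h1 : ∀ i ∈ σ, F.component σ b (AddMonoidAlgebra.single c x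
            * AddMonoidAlgebra.single (F.ρ i) ((χ (F.ray i) : ℚ) : STz N))
            = ((χ (F.ray i) : ℚ) : STz N) * RatFunc.C (F.u σ i)
              * F.component σ b (AddMonoidAlgebra.single c x) := by
          intro i hi
          rw [AddMonoidAlgebra.single_mul_single, hσ.component_shift b c hi, component_single,
            component_single]
          ring
        rw [Finset.sum_congr rfl h1, ← Finset.sum_mul, hσ.charST_eq χ, component_single,
          component_single]
        simp only [map_sum, map_mul, map_ratCast]
        ring
  have hall : ∀ q ∈ F.crIdeal, ∀ f : AddMonoidAlgebra (STz N) N,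
      F.component σ b (f * F.chart σ q) = 0 := by
    intro q hq
    induction hq using Submodule.span_induction with
    | mem q hq => exact hgen q hq
    | zero => intro f; rw [map_zero, MulZeroClass.mul_zero, map_zero]
    | add q r _ _ h1 h2 => intro f; rw [map_add, _root_.mul_add, map_add, h1, h2, add_zero]
    | smul a q _ h =>
      intro f
      rw [smul_eq_mul, map_mul (F.chart σ), ← mul_assoc]
      exact h _
  simpa using hall p hp 1

end

/-- The restriction of localized Chen-Ruan classes to the component `I𝒳_{σ,b}` of the inertia stack
of the torus-fixed point of a top-dimensional cone `σ`, where `b ∈ Box(σ)`: the linear map with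
`y^c ↦ ∏_{i ∈ σ} u_i(σ) ^ k i` if `c̄ ∈ σ` and `c = b + ∑_{i ∈ σ} k i • ρ i`, and
`y^c ↦ 0` for all other `c`. -/
def restrict {σ : Finset (Fin n)} (hσ : F.IsTop σ) (b : N) : F.CR →ₗ[STz N] STz N :=
  ((F.crIdeal.restrictScalars (STz N)).liftQ (F.component σ b ∘ₗ (F.chart σ).toLinearMap)
    (fun _ hp => hσ.component_chart_eq_zero b hp))
  ∘ₗ (Submodule.Quotient.restrictScalarsEquiv (STz N) F.crIdeal).symm.toLinearMap

theorem restrict_y {σ : Finset (Fin n)} (hσ : F.IsTop σ) (b c : N) :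
    F.restrict hσ b (F.y c) =
      if bar c ∈ F.cone σ ∧ c - b ∈ F.sublattice σ then
        ∏ i ∈ σ, RatFunc.C (F.u σ i) ^ ⌊F.weight σ i (bar c)⌋ else 0 := by
  have h : F.restrict hσ b (F.y c) = F.component σ b (F.chart σ (MvPolynomial.X c)) := rfl
  rw [h, chart, MvPolynomial.aeval_X]
  by_cases h1 : bar c ∈ F.cone σ
  · rw [if_pos h1, component_single]
    simp [h1]
  · simp [h1]

/-! ### Extended degrees -/

variable {m : ℕ} (s : Fin m → N)

/-- The dual cone `C_σ^∨ ⊆ 𝕃 ⊗ ℚ` of `C_σ = ∑_{i ∉ σ} ℝ_{≥ 0} D_i`; here `𝕃 ⊗ ℚ` is the space of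
the relations `∑ d i ρ̄ i = 0`, and `D_i · d = d i`. -/
def dualCone (σ : Finset (Fin n)) : AddSubmonoid (Fin n → ℚ) where
  carrier := {d | ∑ i, d i • F.ray i = 0 ∧ ∀ i, i ∉ σ → 0 ≤ d i}
  zero_mem' := by simp
  add_mem' := by
    rintro d e ⟨hd, hd'⟩ ⟨he, he'⟩
    refine ⟨?_, fun i hi => add_nonneg (hd' i hi) (he' i hi)⟩
    simp only [Pi.add_apply, add_smul, Finset.sum_add_distrib, hd, he, add_zero]

/-- The rational points of the Mori cone `NE(𝒳) = ∑_{σ ∈ Σ} C_σ^∨`. -/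
def moriCone : AddSubmonoid (Fin n → ℚ) := ⨆ σ ∈ F.cones, F.dualCone σ

/-- The element of `𝕃^S ⊗ ℚ ⊆ ℚ^{n+m}` with components `(d, k)` under the splitting
`𝕃^S ⊗ ℚ ≅ (𝕃 ⊗ ℚ) ⊕ ℚ^m`, i.e. `ι d + ∑ k l • (e_{n+l} - ∑ i, s_{l i} e_i)`. -/
def extDegree (d : Fin n → ℚ) (k : Fin m → ℚ) : Fin n ⊕ Fin m → ℚ :=
  Sum.elim (fun i => d i - ∑ l, k l * F.coord (s l) i) k

/-- The rational points of the extended Mori cone `NE^S(𝒳) = ι(NE(𝒳)) + μ(ℝ_{≥ 0}^m)`. -/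
def extMoriCone : Set (Fin n ⊕ Fin m → ℚ) :=
  {v | ∃ d ∈ F.moriCone, ∃ k : Fin m → ℚ, (∀ l, 0 ≤ k l) ∧ v = F.extDegree s d k}

/-- `Λ^S_σ`. -/
def extLatticeAt (σ : Finset (Fin n)) : Set (Fin n ⊕ Fin m → ℚ) :=
  {v | ∑ i, v (Sum.inl i) • F.ray i + ∑ l, v (Sum.inr l) • bar (s l) = 0 ∧
    (∀ l, ∃ a : ℤ, v (Sum.inr l) = a) ∧ ∀ i, i ∉ σ → ∃ a : ℤ, v (Sum.inl i) = a}

/-- `Λ^S`, the union of the `Λ^S_σ`. -/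
def extLattice : Set (Fin n ⊕ Fin m → ℚ) := {v | ∃ σ ∈ F.cones, v ∈ F.extLatticeAt s σ}

/-- The reduction function `v^S`. -/
def reduction (v : Fin n ⊕ Fin m → ℚ) : N :=
  ∑ i, ⌈v (Sum.inl i)⌉ • F.ρ i + ∑ l, ⌈v (Sum.inr l)⌉ • s l

/-- `ΛE^S_b`. -/
def extEffective (b : N) : Set (Fin n ⊕ Fin m → ℚ) :=
  {v | v ∈ F.extLattice s ∧ F.reduction s v = b ∧ v ∈ F.extMoriCone s}

end StackyFan

/-! ### Formal series in the extended Novikov variables -/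

/-- Formal series in `Q`, `x` and `t`: to an exponent `d` of `Q` and an exponent `k` of `x`
belongs the coefficient of `Q^d x^k`, a power series in `t`. -/
abbrev Series (n m : ℕ) (R : Type*) : Type _ :=
  (Fin n → ℚ) → (Fin m →₀ ℕ) → MvPowerSeries (Fin n) R

namespace Series

variable {n m : ℕ} {R R' : Type*}

/-- Apply a map to all coefficients of a formal series. -/
def mapCoeff (f : R → R') (A : Series n m R) : Series n m R' := fun d k e => f (A d k e)

/-- Multiplication by `Q^l`. -/
def mulQ (l : Fin n → ℚ) (A : Series n m R) : Series n m R := fun d k => A (d - l) k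

end Series

/-- The residue of `f(z) dz` at `z = a`: the coefficient of `(z - a)^{-1}` in the Laurent expansion
of `f` at `a`. -/
def residueAt {K : Type*} [Field K] (a : K) (f : RatFunc K) : K :=
  ((RatFunc.laurent a f : RatFunc K) : LaurentSeries K).coeff (-1)

/-- The rational function `f` has no pole at `a`. -/
def RegularAt {K : Type*} [Field K] (a : K) (f : RatFunc K) : Prop :=
  f.denom.eval a ≠ 0

/-- The value at `a` of a rational function without a pole at `a`. -/
def valueAt {K : Type*} [Field K] (a : K) (f : RatFunc K) : K := f.eval (RingHom.id K) a

namespace StackyFan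

variable {N : Type*} [AddCommGroup N] {n : ℕ} (F : StackyFan N n) {m : ℕ} (s : Fin m → N)

/-! ### The extended I-function -/

/-- The classes `u_i`, `1 ≤ i ≤ n + m`, with `u_i = 0` for `i > n`. -/
def uCR : Fin n ⊕ Fin m → F.CR := Sum.elim (fun i => F.y (F.ρ i)) 0

/-- The `S`-extended `𝕋`-equivariant I-function.  The coefficient of `Q^d x^k` is the sum over
the box elements `b` for which the extended degree `(d, k)` lies in `ΛE^S_b`. -/
def extI : Series n m F.CR := fun d k =>
  let v : Fin n ⊕ Fin m → ℚ := F.extDegree s d (fun l => (k l : ℚ))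
  MvPowerSeries.C (algebraMap (STz N) F.CR RatFunc.X) *
    expT (STz N) (fun i => F.y (F.ρ i) * algebraMap (STz N) F.CR (RatFunc.X)⁻¹) *
    ∑ᶠ b ∈ {b | b ∈ F.box ∧ v ∈ F.extEffective s b},
      expT (STz N) (fun i => algebraMap (STz N) F.CR (d i : STz N)) *
        MvPowerSeries.C ((∏ i, hyperFactor (F.uCR i) (RatFunc.X : STz N) (v i)) * F.y b)

/-- The restriction `I^S_{(σ,b)}` of the I-function. -/
def extIAt {σ : Finset (Fin n)} (hσ : F.IsTop σ) (b : N) : Series n m (STz N) :=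
  (F.extI s).mapCoeff (F.restrict hσ b)

/-! ### The recursion coefficient -/

/-- `l(c, σ, j) ∈ 𝕃 ⊗ ℚ`: the unique relation between the `ρ̄ i`, `i ∈ σ ∪ σ'`, in which `ρ̄ j` has
the coefficient `c`. -/
def curveDegree (σ σ' : Finset (Fin n)) (j : Fin n) (c : ℚ) : Fin n → ℚ :=
  if h : ∃ d : Fin n → ℚ, d j = c ∧ (∀ i, i ∉ σ ∪ σ' → d i = 0) ∧ ∑ i, d i • F.ray i = 0
  then h.choose else 0

/-- `b'` is the box element at the second fixed point determined by `σ`, `σ'`, `b`, `c`. -/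
def IsOpposite (σ σ' : Finset (Fin n)) (j j' : Fin n) (b : N) (c : ℚ) (b' : N) : Prop :=
  b' ∈ F.boxOf σ' ∧ ∃ q : ℕ, F.hat b + ⌊c⌋ • F.ρ j + q • F.ρ j' + b' ∈ F.sublattice (σ ∩ σ')

/-- The recursion coefficient `RC(c)_{(σ,b)}^{(σ',b')}`, an element of `S_𝕋`. -/
def recursionCoeff (σ σ' : Finset (Fin n)) (j j' : Fin n) (b : N) (c : ℚ) : ST N :=
  let l := F.curveDegree σ σ' j c
  let w : ST N := (c : ST N) / F.u σ j
  1 / (c : ST N) * (∏ i ∈ σ with F.coord b i = 0, F.u σ i)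
    * (w ^ ⌊c⌋₊ / (Nat.factorial ⌊c⌋₊ : ST N))
    * ((-w) ^ ⌊l j'⌋₊ / (Nat.factorial ⌊l j'⌋₊ : ST N))
    * ∏ i ∈ σ ∩ σ',
        prodQuot {a | Int.fract a = F.coord (F.hat b) i ∧ a < 0}
          {a | Int.fract a = F.coord (F.hat b) i ∧ a ≤ l i}
          (fun a => F.u σ i + F.u σ j * ((a : ST N) / (-(c : ST N))))

end StackyFan
end ToricStack
end

/-! Restrict `I^S` to the component of `(σ, b)`. A degree `λ = (d, k)` survives only if its
reduction is `b`, `d` is a relation and `λ_i ∈ ℕ` for all `i ∉ σ`. If some such `λ_i` is a negative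
integer, then the numerator contains `u_i(σ) = 0` (`contributes_of_mem_extEffective`,
`extIAt_apply`). What remains is an explicit rational function of `z`: an exponential coefficient
times one hypergeometric factor per class.

At `z = -u_j(σ)/c` a denominator `u_i(σ) + a z` is a multiple of the character `u_i(σ) - (a/c)
u_j(σ)`, or of `z` itself. It vanishes only for `i = j`, `a = c` (`u_left_add_ne_zero`). Hence the
pole is at most simple, it occurs exactly when `c ≤ λ_j`, and the residue is the value of the
remaining factors.

The two fixed points are linked by `u_i(σ') = u_i(σ) + l_i z` at this `z` (`Adjacent.u_right`),
where `l = l(c, σ, j)`. Shifting the product index by `l_i` turns the factor of `λ_i` at `σ` into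
the factor of `λ_i - l_i` at `σ'`, up to an elementary quotient (`hyperFactor_shift` and its
consequences). These quotients, together with `1/c`, multiply to `RC(c)` (`recursionCoeff_eq`). The
same identity makes the exponentials agree (`u_mul_inv_add`).

It remains to match degrees. The map `λ ↦ λ - l` sends the degrees for `(σ, b)` with `c ≤ λ_j` to
degrees for `(σ', b')`, where `b'` has the coordinates `⟨b_i + l_i⟩` (`contributes_right`). The
degrees it misses have `λ_{j'} < 0` (`contributes_left`), and there the value at `σ'` is zero
because the factor of `j'` contains `0` in its numerator (`hyperFactor_eq_zero`).

Since the series live over the Chen-Ruan ring, the denominators must be units before restriction.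
This is checked modulo each maximal ideal, where the `u_i` become weights at a fixed point
(`exists_isTop_sub_mem`). -/

namespace ToricStack

/-! ### Values and residues of rational functions -/

section RationalFunctions

variable {K : Type*} [Field K]

/-- The rational function `f` is regular at `a`, with the value `v`. -/
def HasValueAt (a : K) (f : RatFunc K) (v : K) : Prop :=
  ∃ p q : Polynomial K, q.eval a ≠ 0 ∧
    f = algebraMap (Polynomial K) (RatFunc K) p / algebraMap (Polynomial K) (RatFunc K) q ∧
    v = p.eval a / q.eval a

namespace HasValueAt

variable {a v w : K} {f g : RatFunc K}

theorem C (a x : K) : HasValueAt a (RatFunc.C x) x :=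
  ⟨Polynomial.C x, 1, by simp, by simp, by simp⟩

theorem X (a : K) : HasValueAt a RatFunc.X a := ⟨Polynomial.X, 1, by simp, by simp, by simp⟩

theorem one (a : K) : HasValueAt a 1 1 := by simpa using C a 1

theorem algebraMap_ne_zero {q : Polynomial K} (h : q.eval a ≠ 0) :
    algebraMap (Polynomial K) (RatFunc K) q ≠ 0 := by
  apply RatFunc.algebraMap_ne_zero
  rintro rfl
  simp at h

theorem add (hf : HasValueAt a f v) (hg : HasValueAt a g w) : HasValueAt a (f + g) (v + w) := by
  obtain ⟨p, q, hq, rfl, rfl⟩ := hf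
  obtain ⟨p', q', hq', rfl, rfl⟩ := hg
  have h1 := algebraMap_ne_zero hq
  have h2 := algebraMap_ne_zero hq'
  refine ⟨p * q' + q * p', q * q', by simp [hq, hq'], ?_, ?_⟩
  · simp only [map_add, map_mul]
    rw [div_add_div _ _ h1 h2]
  · simp only [Polynomial.eval_add, Polynomial.eval_mul]
    rw [div_add_div _ _ hq hq']

theorem mul (hf : HasValueAt a f v) (hg : HasValueAt a g w) : HasValueAt a (f * g) (v * w) := by
  obtain ⟨p, q, hq, rfl, rfl⟩ := hf
  obtain ⟨p', q', hq', rfl, rfl⟩ := hg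
  refine ⟨p * p', q * q', by simp [hq, hq'], ?_, ?_⟩
  · simp only [map_mul, div_mul_div_comm]
  · simp only [Polynomial.eval_mul, div_mul_div_comm]

theorem inv (hf : HasValueAt a f v) (hv : v ≠ 0) : HasValueAt a f⁻¹ v⁻¹ := by
  obtain ⟨p, q, hq, rfl, rfl⟩ := hf
  refine ⟨q, p, fun h => hv (by simp [h]), by rw [inv_div], by rw [inv_div]⟩

theorem pow (hf : HasValueAt a f v) (k : ℕ) : HasValueAt a (f ^ k) (v ^ k) := by
  induction k with
  | zero => simpa using one a
  | succ k ih => simpa only [pow_succ] using ih.mul hf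

theorem prod {ι : Type*} (s : Finset ι) {f : ι → RatFunc K} {v : ι → K}
    (h : ∀ i ∈ s, HasValueAt a (f i) (v i)) : HasValueAt a (∏ i ∈ s, f i) (∏ i ∈ s, v i) := by
  induction s using Finset.induction_on with
  | empty => simpa using one a
  | insert i s hi ih =>
    rw [Finset.prod_insert hi, Finset.prod_insert hi]
    exact (h i (by simp)).mul (ih fun k hk => h k (by simp [hk]))

theorem finprod {s : Set ℚ} (hs : s.Finite) {f : ℚ → RatFunc K} {v : ℚ → K}
    (h : ∀ i ∈ s, HasValueAt a (f i) (v i)) :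
    HasValueAt a (∏ᶠ i ∈ s, f i) (∏ᶠ i ∈ s, v i) := by
  rw [finprod_mem_eq_finite_toFinset_prod _ hs, finprod_mem_eq_finite_toFinset_prod _ hs]
  exact prod _ fun i hi => h i (by simpa using hi)

/-- The reduced denominator divides every denominator, so it cannot vanish where `q` does not. -/
theorem regularAt (hf : HasValueAt a f v) : RegularAt a f := by
  obtain ⟨p, q, hq, rfl, rfl⟩ := hf
  intro h
  apply hq
  obtain ⟨r, hr⟩ := RatFunc.denom_div_dvd p q
  rw [hr, Polynomial.eval_mul, h, zero_mul]

theorem valueAt_eq (hf : HasValueAt a f v) : valueAt a f = v := by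
  have hreg : (RatFunc.denom f).eval a ≠ 0 := hf.regularAt
  obtain ⟨p, q, hq, hf, rfl⟩ := hf
  have h1 := algebraMap_ne_zero hq
  have h2 := algebraMap_ne_zero hreg
  have key : RatFunc.num f * q = p * RatFunc.denom f := by
    apply RatFunc.algebraMap_injective K
    rw [map_mul, map_mul, ← div_eq_div_iff h2 h1, RatFunc.num_div_denom, hf]
  have := congrArg (Polynomial.eval a) key
  rw [Polynomial.eval_mul, Polynomial.eval_mul] at this
  rw [valueAt, RatFunc.eval, Polynomial.eval₂_id, Polynomial.eval₂_id, div_eq_div_iff hreg hq, this]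

/-- The Taylor shifts of numerator and denominator at `a` have their values at `a` as constant
terms, so the shifted denominator is invertible as a power series. -/
theorem laurent_eq (hf : HasValueAt a f v) : ∃ P : PowerSeries K,
    ((RatFunc.laurent a f : RatFunc K) : LaurentSeries K) = HahnSeries.ofPowerSeries ℤ K P ∧
      PowerSeries.constantCoeff P = v := by
  obtain ⟨p, q, hq, rfl, rfl⟩ := hf
  have hc : ∀ r : Polynomial K, PowerSeries.constantCoeff
      ((Polynomial.taylor a r : Polynomial K) : PowerSeries K) = r.eval a := by
    intro r
    rw [← PowerSeries.coeff_zero_eq_constantCoeff_apply, Polynomial.coeff_coe,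
      Polynomial.taylor_coeff_zero]
  refine ⟨(Polynomial.taylor a p : Polynomial K) *
    ((Polynomial.taylor a q : Polynomial K) : PowerSeries K)⁻¹, ?_, ?_⟩
  · rw [RatFunc.laurent_div, map_mul, map_div₀]
    have hne : PowerSeries.constantCoeff
      ((Polynomial.taylor a q : Polynomial K) : PowerSeries K) ≠ 0 := by rwa [hc]
    have hmul : HahnSeries.ofPowerSeries ℤ K
          ((Polynomial.taylor a q : Polynomial K) : PowerSeries K)
        * HahnSeries.ofPowerSeries ℤ K
          ((Polynomial.taylor a q : Polynomial K) : PowerSeries K)⁻¹ = 1 := by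
      rw [← map_mul, PowerSeries.mul_inv_cancel _ hne, map_one]
    have hcoe : ∀ r : Polynomial K,
        ((algebraMap (Polynomial K) (RatFunc K) r : RatFunc K) : LaurentSeries K) =
        HahnSeries.ofPowerSeries ℤ K (r : PowerSeries K) := fun r =>
      (RatFunc.coe_coe r).symm
    rw [hcoe, hcoe, div_eq_iff (left_ne_zero_of_mul_eq_one hmul), mul_assoc, mul_comm _
      (HahnSeries.ofPowerSeries ℤ K ((Polynomial.taylor a q : Polynomial K) : PowerSeries K)),
      hmul, mul_one]
  · rw [map_mul, PowerSeries.constantCoeff_inv, hc, hc, div_eq_mul_inv]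

theorem residueAt_eq_zero (hf : HasValueAt a f v) : residueAt a f = 0 := by
  obtain ⟨P, hP, -⟩ := hf.laurent_eq
  rw [residueAt, hP, PowerSeries.coeff_coe, if_pos (by norm_num)]

/-- Residue at a simple pole: recentring at `a` turns `X - C a` into `X`, so the coefficient of
index `-1` is the constant term of the regular part. -/
theorem residueAt_mul_inv (hf : HasValueAt a f v) :
    residueAt a (f * (RatFunc.X - RatFunc.C a)⁻¹) = v := by
  obtain ⟨P, hP, hv⟩ := hf.laurent_eq
  rw [residueAt, map_mul, map_inv₀, map_sub, RatFunc.laurent_X, RatFunc.laurent_C,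
    add_sub_cancel_right]
  have : ((RatFunc.laurent a f * RatFunc.X⁻¹ : RatFunc K) : LaurentSeries K)
      = HahnSeries.single (-1 : ℤ) (1 : K) * HahnSeries.ofPowerSeries ℤ K P := by
    rw [← hP, mul_comm, map_mul, map_inv₀, RatFunc.coe_X,
      show HahnSeries.single (-1 : ℤ) (1 : K) = HahnSeries.single (-(1 : ℤ)) (1 : K)⁻¹ by
        rw [inv_one],
      HahnSeries.inv_single]
  rw [this, HahnSeries.coeff_single_mul, sub_self, one_mul, ← hv,
    ← PowerSeries.coeff_zero_eq_constantCoeff_apply]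
  exact LaurentSeries.coeff_coe_powerSeries P 0

end HasValueAt

end RationalFunctions

/-! ### Quotients of infinite products -/

section Quotients

theorem finite_fract_Ioc (r x y : ℚ) : {a : ℚ | Int.fract a = r ∧ x < a ∧ a ≤ y}.Finite := by
  apply Set.Finite.subset ((Set.finite_Icc ⌊x⌋ ⌊y⌋).image (fun n : ℤ => (n : ℚ) + r))
  rintro a ⟨h, h1, h2⟩
  exact ⟨⌊a⌋, ⟨Int.floor_le_floor h1.le, Int.floor_le_floor h2⟩, by
    rw [← h]; exact Int.floor_add_fract a⟩

/-- The rational numbers `a ≤ x` with fractional part `r`. -/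
def fractIic (r x : ℚ) : Set ℚ := {a | Int.fract a = r ∧ a ≤ x}

theorem finite_fractIic_diff (r x y : ℚ) : (fractIic r x \ fractIic r y).Finite := by
  apply (finite_fract_Ioc r y x).subset
  rintro a ⟨⟨h1, h2⟩, h3⟩
  exact ⟨h1, not_le.1 fun h => h3 ⟨h1, h⟩, h2⟩

theorem fractIic_mono (r : ℚ) {x y : ℚ} (h : x ≤ y) : fractIic r x ⊆ fractIic r y :=
  fun _ ha => ⟨ha.1, ha.2.trans h⟩

variable {K : Type*} [Field K]

theorem finprod_mem_ne_zero {s : Set ℚ} {f : ℚ → K} (h : ∀ a ∈ s, f a ≠ 0) :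
    ∏ᶠ a ∈ s, f a ≠ 0 :=
  finprod_mem_induction (fun x : K => x ≠ 0) one_ne_zero (fun _ _ => mul_ne_zero) h

theorem finprod_mem_eq_zero {s : Set ℚ} (hs : s.Finite) {f : ℚ → K} {a : ℚ} (ha : a ∈ s)
    (h : f a = 0) : ∏ᶠ a ∈ s, f a = 0 := by
  rw [finprod_mem_eq_finite_toFinset_prod _ hs]
  exact Finset.prod_eq_zero (by simpa using ha) h

/-- `Z` is an infinite tail common to both products. Once it is removed, both are finite, and
cancelling the rest of the overlap requires its factors to be nonzero. -/
theorem prodQuot_eq_div {A B Z : Set ℚ} {f : ℚ → K} (hA : Z ⊆ A) (hB : Z ⊆ B)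
    (fA : (A \ Z).Finite) (fB : (B \ Z).Finite) (hf : ∀ a ∈ (A ∩ B) \ Z, f a ≠ 0) :
    prodQuot A B f = (∏ᶠ a ∈ A \ Z, f a) / ∏ᶠ a ∈ B \ Z, f a := by
  have hI : ((A ∩ B) \ Z).Finite := fA.subset fun a h => ⟨h.1.1, h.2⟩
  have h1 : A \ Z = (A \ B) ∪ ((A ∩ B) \ Z) := by
    ext a
    have := @hB a
    simp only [Set.mem_sdiff, Set.mem_union, Set.mem_inter_iff]
    tauto
  have h2 : B \ Z = (B \ A) ∪ ((A ∩ B) \ Z) := by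
    ext a
    have := @hA a
    simp only [Set.mem_sdiff, Set.mem_union, Set.mem_inter_iff]
    tauto
  have d1 : Disjoint (A \ B) ((A ∩ B) \ Z) :=
    Set.disjoint_left.2 fun a h h' => h.2 h'.1.2
  have d2 : Disjoint (B \ A) ((A ∩ B) \ Z) :=
    Set.disjoint_left.2 fun a h h' => h.2 h'.1.1
  have e1 : ∏ᶠ a ∈ A \ Z, f a = (∏ᶠ a ∈ A \ B, f a) * ∏ᶠ a ∈ (A ∩ B) \ Z, f a := by
    rw [← finprod_mem_union d1 (fA.subset fun a h => ⟨h.1, fun hz => h.2 (hB hz)⟩) hI, ← h1]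
  have e2 : ∏ᶠ a ∈ B \ Z, f a = (∏ᶠ a ∈ B \ A, f a) * ∏ᶠ a ∈ (A ∩ B) \ Z, f a := by
    rw [← finprod_mem_union d2 (fB.subset fun a h => ⟨h.1, fun hz => h.2 (hA hz)⟩) hI, ← h2]
  rw [e1, e2, mul_div_mul_right _ _ (finprod_mem_ne_zero hf), prodQuot, Ring.inverse_eq_inv',
    div_eq_mul_inv]

/-- With one cut `t` below all bounds involved, quotients over different ranges become honest
fractions that can be multiplied. -/
theorem prodQuot_fractIic {r x y t : ℚ} {f : ℚ → K} (hx : t ≤ x) (hy : t ≤ y)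
    (hf : ∀ a, Int.fract a = r → t < a → a ≤ x → a ≤ y → f a ≠ 0) :
    prodQuot (fractIic r x) (fractIic r y) f =
      (∏ᶠ a ∈ fractIic r x \ fractIic r t, f a) / ∏ᶠ a ∈ fractIic r y \ fractIic r t, f a :=
  prodQuot_eq_div (fractIic_mono r hx) (fractIic_mono r hy) (finite_fractIic_diff _ _ _)
    (finite_fractIic_diff _ _ _) fun a ha =>
      hf a ha.1.1.1 (not_le.1 fun h => ha.2 ⟨ha.1.1.1, h⟩) ha.1.1.2 ha.1.2.2

/-! ### Hypergeometric factors under a shift of the weight. -/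

theorem fract_add_eq_iff (a x l : ℚ) : Int.fract a = Int.fract (x - l) ↔
    Int.fract (a + l) = Int.fract x := by
  rw [Int.fract_eq_fract, Int.fract_eq_fract, sub_sub_eq_add_sub]

/-- Substitute `a ↦ a + l`: the bounds `0` and `x - l` become `l` and `x`. The left side is the
shape of a factor at `σ'`, the right side uses only the weight at `σ`. -/
theorem hyperFactor_shift {u z : K} [CharZero K] (x l : ℚ) :
    hyperFactor (K := K) (u + (l : K) * z) z (x - l) =
      prodQuot (fractIic (Int.fract x) l) (fractIic (Int.fract x) x)
        (fun a => u + (a : K) * z) := by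
  have key : ∀ S : Set ℚ, ∀ T : Set ℚ, (∀ a, a ∈ S ↔ a + l ∈ T) →
      ∏ᶠ a ∈ S, ((u + (l : K) * z) + algebraMap K K ((a : K) * z)) =
        ∏ᶠ a ∈ T, (u + (a : K) * z) := by
    intro S T hST
    refine finprod_mem_eq_of_bijOn (fun a => a + l) ⟨fun a ha => (hST a).1 ha,
      fun a _ b _ h => add_right_cancel h, fun a ha => ⟨a - l, (hST _).2 (by simpa), by simp⟩⟩ ?_
    intro a _
    rw [Algebra.algebraMap_self, RingHom.id_apply]
    push_cast
    ring
  rw [hyperFactor, prodQuot, prodQuot, key _ (fractIic (Int.fract x) l \ fractIic (Int.fract x) x),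
    key _ (fractIic (Int.fract x) x \ fractIic (Int.fract x) l)]
  all_goals
    intro a
    simp only [Set.mem_sdiff, Set.mem_ofPred_eq, fractIic, fract_add_eq_iff, le_sub_iff_add_le,
      add_le_iff_nonpos_left]

theorem hyperFactor_eq (u z : K) (x : ℚ) :
    hyperFactor (K := K) u z x = prodQuot (fractIic (Int.fract x) 0) (fractIic (Int.fract x) x)
        (fun a => u + (a : K) * z) := rfl

/-- The factor of a ray of the common face, at the two fixed points. -/
theorem hyperFactor_eq_mul [CharZero K] {u z : K} (x l : ℚ) (h : ∀ a : ℚ, u + (a : K) * z ≠ 0) :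
    hyperFactor (K := K) u z x = (if Int.fract x = 0 then u else 1) *
      prodQuot {a | Int.fract a = Int.fract x ∧ a < 0} (fractIic (Int.fract x) l)
        (fun a => u + (a : K) * z) *
      hyperFactor (K := K) (u + (l : K) * z) z (x - l) := by
  rw [hyperFactor_shift, hyperFactor_eq]
  set r := Int.fract x
  set f : ℚ → K := fun a => u + (a : K) * z
  -- The bound `-1` makes the tail lie in `a < 0` and keeps `a = 0` outside it.
  set t : ℚ := min (min l x) (-1)
  have tl : t ≤ l := (min_le_left _ _).trans (min_le_left _ _)
  have tx : t ≤ x := (min_le_left _ _).trans (min_le_right _ _)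
  have t1 : t ≤ -1 := min_le_right _ _
  have t0 : t ≤ 0 := t1.trans (by norm_num)
  have hN : {a : ℚ | Int.fract a = r ∧ a < 0} ⊆ fractIic r 0 := fun a ha => ⟨ha.1, ha.2.le⟩
  rw [prodQuot_fractIic t0 tx (fun a _ _ _ _ => h a), prodQuot_fractIic tl tx
    (fun a _ _ _ _ => h a), prodQuot_eq_div (A := {a | Int.fract a = r ∧ a < 0})
      (B := fractIic r l) (Z := fractIic r t)
      (fun a ha => ⟨ha.1, by linarith [ha.2]⟩) (fractIic_mono r tl)
      ((finite_fractIic_diff r 0 t).subset fun a ha => ⟨hN ha.1, ha.2⟩)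
      (finite_fractIic_diff r l t) (fun a _ => h a)]
  have g : ∀ S : Set ℚ, ∏ᶠ a ∈ S, f a ≠ 0 := fun S => finprod_mem_ne_zero fun a _ => h a
  -- The factor has `a ≤ 0` where the recursion coefficient has `a < 0`. They differ by the term `u`
  -- at `a = 0`, which occurs only for integral `x`.
  have key : ∏ᶠ a ∈ fractIic r 0 \ fractIic r t, f a = (if r = 0 then u else 1) *
      ∏ᶠ a ∈ {a : ℚ | Int.fract a = r ∧ a < 0} \ fractIic r t, f a := by
    split_ifs with hr
    · have : fractIic r 0 \ fractIic r t =
          insert 0 ({a : ℚ | Int.fract a = r ∧ a < 0} \ fractIic r t) := by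
        ext a
        simp only [fractIic, Set.mem_sdiff, Set.mem_ofPred_eq, Set.mem_insert_iff, le_iff_lt_or_eq]
        constructor
        · rintro ⟨⟨h1, h2 | h2⟩, h3⟩
          · exact Or.inr ⟨⟨h1, h2⟩, h3⟩
          · exact Or.inl h2
        · rintro (rfl | ⟨⟨h1, h2⟩, h3⟩)
          · refine ⟨⟨by simp [hr], Or.inr rfl⟩, fun h => ?_⟩
            rcases h.2 with h | h <;> linarith
          · exact ⟨⟨h1, Or.inl h2⟩, h3⟩
      rw [this, finprod_mem_insert]
      · simp [f]
      · simp
      · exact (finite_fractIic_diff r 0 t).subset fun a ha => ⟨hN ha.1, ha.2⟩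
    · have : fractIic r 0 = {a : ℚ | Int.fract a = r ∧ a < 0} := by
        ext a
        refine ⟨fun ha => ⟨ha.1, lt_of_le_of_ne ha.2 ?_⟩, fun ha => hN ha⟩
        rintro rfl
        exact hr (by simpa using ha.1.symm)
      rw [this, one_mul]
  rw [key]
  have g1 := g (fractIic r l \ fractIic r t)
  have g2 := g (fractIic r x \ fractIic r t)
  rw [mul_assoc, div_mul_div_cancel₀ g1, mul_div_assoc]

/-- The index set consists of the integers `1, …, ⌊y⌋`; for `y < 0` it is empty and `⌊y⌋₊ = 0`. -/
theorem finprod_fractIic_zero [CharZero K] (z : K) (y : ℚ) :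
    ∏ᶠ a ∈ fractIic 0 y \ fractIic 0 0, ((a : K) * z) = (Nat.factorial ⌊y⌋₊ : K) * z ^ ⌊y⌋₊ := by
  have h1 : ∏ᶠ a ∈ fractIic 0 y \ fractIic 0 0, ((a : K) * z) =
      ∏ᶠ k ∈ (Finset.Ico 1 (⌊y⌋₊ + 1) : Set ℕ), ((k : K) * z) := by
    symm
    refine finprod_mem_eq_of_bijOn (fun k : ℕ => (k : ℚ)) ⟨?_, ?_, ?_⟩ ?_
    · intro k hk
      have hk' : 1 ≤ k ∧ k ≤ ⌊y⌋₊ := by simpa [Nat.lt_succ_iff] using hk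
      have : k ≤ ⌊y⌋₊ ∧ k ≠ 0 := ⟨hk'.2, by omega⟩
      refine ⟨⟨by simp, (Nat.le_floor_iff' this.2).1 this.1⟩, fun h => ?_⟩
      have h2 : (k : ℚ) ≤ 0 := h.2
      have : k ≤ 0 := by exact_mod_cast h2
      omega
    · intro a _ b _ hab
      exact Nat.cast_injective hab
    · rintro a ⟨⟨ha, hy⟩, hn⟩
      have hpos : 0 < a := not_le.1 fun h => hn ⟨ha, h⟩
      have h2 : (⌊a⌋ : ℚ) = a := by
        have := Int.floor_add_fract a
        rw [ha, add_zero] at this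
        exact this
      have h3 : 0 ≤ ⌊a⌋ := Int.floor_nonneg.2 hpos.le
      lift ⌊a⌋ to ℕ using h3 with k hk
      have h4 : (k : ℚ) = a := by exact_mod_cast h2
      refine ⟨k, ?_, h4⟩
      have hk0 : k ≠ 0 := by rintro rfl; simp at h4; linarith
      have := (Nat.le_floor_iff' (a := y) hk0).2 (by rw [h4]; exact hy)
      simp only [Finset.coe_Ico, Set.mem_Ico]
      omega
    · intro k _
      simp
  rw [h1, finprod_mem_coe_finset, Finset.prod_mul_distrib, Finset.prod_const, Nat.card_Ico,
    Nat.add_sub_cancel, ← Finset.prod_Ico_id_eq_factorial]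
  push_cast
  rfl

/-- The factor of the ray of the second fixed point that is not on the common face. -/
theorem hyperFactor_zero_eq_mul [CharZero K] {z : K} (hz : z ≠ 0) {x l : ℚ} (hl : 0 ≤ l)
    (hx : 0 ≤ x) (hx' : Int.fract x = 0) :
    hyperFactor (K := K) 0 z x = (z⁻¹ ^ ⌊l⌋₊ / (Nat.factorial ⌊l⌋₊ : K)) *
      hyperFactor (K := K) ((l : K) * z) z (x - l) := by
  have h1 := hyperFactor_shift (K := K) (u := 0) (z := z) x l
  rw [zero_add] at h1
  have h2 : ∀ a : ℚ, Int.fract a = Int.fract x → (0 : ℚ) < a → (0 : K) + (a : K) * z ≠ 0 := by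
    intro a _ ha
    rw [zero_add]
    exact mul_ne_zero (by exact_mod_cast ha.ne') hz
  -- The cut is exactly `0`: the term `a = 0` vanishes and must lie in the removed tail.
  rw [h1, hyperFactor_eq, prodQuot_fractIic hl hx (fun a ha h _ _ => h2 a ha h),
    prodQuot_fractIic le_rfl hx (fun a ha h _ _ => h2 a ha h), Set.sdiff_self, finprod_mem_empty]
  simp only [zero_add, hx']
  rw [finprod_fractIic_zero z l]
  have h3 : (Nat.factorial ⌊l⌋₊ : K) ≠ 0 := by exact_mod_cast Nat.factorial_ne_zero _
  have h4 : z ^ ⌊l⌋₊ ≠ 0 := pow_ne_zero _ hz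
  rw [← mul_div_assoc, inv_pow]
  congr 1
  field_simp

theorem prodQuot_eq_zero {A B : Set ℚ} {f : ℚ → K} (h : (A \ B).Finite) {a : ℚ} (ha : a ∈ A \ B)
    (hf : f a = 0) : prodQuot A B f = 0 := by
  rw [prodQuot, finprod_mem_eq_zero h ha hf, zero_mul]

/-- After the shift by `l`, the numerator contains the vanishing term `a = 0`, and `x < 0` keeps it
from being cancelled. The case `l = 0` discards degrees at `σ`; the case `l = l_{j'}` discards the
unmatched degrees at `σ'`. -/
theorem hyperFactor_eq_zero {z : K} {x l : ℚ} [CharZero K] (hl : 0 ≤ l) (hx : x < 0)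
    (hx' : Int.fract x = 0) : hyperFactor (K := K) ((l : K) * z) z (x - l) = 0 := by
  have h1 := hyperFactor_shift (K := K) (u := 0) (z := z) x l
  rw [zero_add] at h1
  rw [h1]
  refine prodQuot_eq_zero (finite_fractIic_diff _ _ _) (a := 0) ⟨⟨?_, hl⟩, fun h => ?_⟩ (by simp)
  · simp [hx']
  · exact absurd h.2 (not_le.2 hx)

/-- The residue factor of the ray of the first fixed point that is not on the common face. -/
theorem residue_factor_eq [CharZero K] {u z : K} {x c : ℚ} (hc : 0 < c) (hcx : c ≤ x)
    (hf : Int.fract x = Int.fract c) (hu : u ≠ 0) (hz : z = -u / (c : K)) :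
    (∏ᶠ a ∈ (fractIic (Int.fract x) x \ fractIic (Int.fract x) 0) \ {c},
        (u + (a : K) * z))⁻¹ =
      (if Int.fract c = 0 then u else 1) *
        (((c : K) / u) ^ ⌊c⌋₊ / (Nat.factorial ⌊c⌋₊ : K)) *
        hyperFactor (K := K) (u + (c : K) * z) z (x - c) := by
  have hcK : (c : K) ≠ 0 := by exact_mod_cast hc.ne'
  rw [hyperFactor_shift, hf]
  set r := Int.fract c with hr
  set f : ℚ → K := fun a => u + (a : K) * z with hfdef
  -- Since `z = -u/c`, every factor is a rational multiple of `u/c` and vanishes only at `a = c`.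
  have hfa : ∀ a : ℚ, f a = ((c - a : ℚ) : K) * (u / c) := by
    intro a
    simp only [hfdef, hz]
    push_cast
    field_simp
    ring
  have hne : ∀ a : ℚ, a ≠ c → f a ≠ 0 := by
    intro a ha
    rw [hfa]
    exact mul_ne_zero (by exact_mod_cast sub_ne_zero.2 ha.symm) (div_ne_zero hu hcK)
  -- Cutting at `c` puts the vanishing factor into the tail; only the terms with `c < a ≤ x` remain,
  -- and `S` collects those with `0 < a < c`.
  rw [prodQuot_fractIic le_rfl hcx (fun a _ h1 h2 _ => absurd h1 (not_lt.2 h2)), Set.sdiff_self,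
    finprod_mem_empty]
  set S : Set ℚ := {a | Int.fract a = r ∧ 0 < a ∧ a < c} with hS
  have hSf : S.Finite := (finite_fract_Ioc r 0 c).subset fun a ha => ⟨ha.1, ha.2.1, ha.2.2.le⟩
  have hset : (fractIic r x \ fractIic r 0) \ {c} = S ∪ (fractIic r x \ fractIic r c) := by
    ext a
    simp only [hS, fractIic, Set.mem_sdiff, Set.mem_ofPred_eq, Set.mem_union, Set.mem_singleton_iff,
      not_and, not_le]
    constructor
    · rintro ⟨⟨⟨h1, h2⟩, h3⟩, h4⟩
      rcases lt_or_gt_of_ne h4 with h | h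
      · exact Or.inl ⟨h1, h3 h1, h⟩
      · exact Or.inr ⟨⟨h1, h2⟩, fun _ => h⟩
    · rintro (⟨h1, h2, h3⟩ | ⟨⟨h1, h2⟩, h3⟩)
      · exact ⟨⟨⟨h1, by linarith⟩, fun _ => h2⟩, h3.ne⟩
      · exact ⟨⟨⟨h1, h2⟩, fun _ => hc.trans (h3 h1)⟩, (h3 h1).ne'⟩
  have hdis : Disjoint S (fractIic r x \ fractIic r c) :=
    Set.disjoint_left.2 fun a h h' => h'.2 ⟨h.1, h.2.2.le⟩
  rw [hset, finprod_mem_union hdis hSf (finite_fractIic_diff _ _ _)]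
  have hfin : (if r = 0 then u else 1) * ∏ᶠ a ∈ S, f a =
      (Nat.factorial ⌊c⌋₊ : K) * (u / c) ^ ⌊c⌋₊ := by
    rw [← finprod_fractIic_zero (u / (c : K)) c]
    -- The reflection `a ↦ c - a` carries this set onto the integers `1, …, ⌊c⌋`, which yields the
    -- factorial. The point `a = 0` belongs to it only for integral `c`, whence the extra `u`.
    have hT : ∏ᶠ a ∈ {a : ℚ | Int.fract a = r ∧ 0 ≤ a ∧ a < c}, f a =
        ∏ᶠ a ∈ fractIic 0 c \ fractIic 0 0, ((a : K) * (u / c)) := by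
      refine finprod_mem_eq_of_bijOn (fun a => c - a) ⟨?_, fun a _ b _ h => sub_right_injective h,
        ?_⟩ (fun a _ => hfa a)
      · rintro a ⟨h1, h2, h3⟩
        have h4 : Int.fract (c - a) = 0 := by
          obtain ⟨k, hk⟩ := Int.fract_eq_fract.1 h1.symm
          rw [hk, Int.fract_intCast]
        exact ⟨⟨h4, by linarith⟩, fun h => by have h5 : c - a ≤ 0 := h.2; linarith⟩
      · rintro a ⟨⟨h1, h2⟩, h3⟩
        refine ⟨c - a, ⟨?_, by linarith, ?_⟩, by ring⟩
        · obtain ⟨k, hk⟩ := Int.fract_eq_zero_iff.1 h1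
          rw [← hk, Int.fract_sub_intCast]
        · have : 0 < a := not_le.1 fun h => h3 ⟨h1, h⟩
          linarith
    rw [← hT]
    split_ifs with h0
    · have : {a : ℚ | Int.fract a = r ∧ 0 ≤ a ∧ a < c} = insert 0 S := by
        ext a
        simp only [hS, Set.mem_ofPred_eq, Set.mem_insert_iff]
        constructor
        · rintro ⟨h1, h2, h3⟩
          rcases h2.eq_or_lt with h | h
          · exact Or.inl h.symm
          · exact Or.inr ⟨h1, h, h3⟩
        · rintro (rfl | ⟨h1, h2, h3⟩)
          · exact ⟨by simp [h0], le_rfl, hc⟩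
          · exact ⟨h1, h2.le, h3⟩
      rw [this, finprod_mem_insert _ (by simp [hS]) hSf]
      simp [hfdef]
    · have : {a : ℚ | Int.fract a = r ∧ 0 ≤ a ∧ a < c} = S := by
        ext a
        refine ⟨fun h => ⟨h.1, lt_of_le_of_ne h.2.1 ?_, h.2.2⟩, fun h => ⟨h.1, h.2.1.le, h.2.2⟩⟩
        rintro rfl
        exact h0 (by simpa using h.1.symm)
      rw [this, one_mul]
  have hG : ∏ᶠ a ∈ S, f a ≠ 0 := finprod_mem_ne_zero fun a ha => hne a ha.2.2.ne
  have hfact : (Nat.factorial ⌊c⌋₊ : K) ≠ 0 := by exact_mod_cast Nat.factorial_ne_zero _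
  have hI : (if r = 0 then u else 1) * (((c : K) / u) ^ ⌊c⌋₊ / (Nat.factorial ⌊c⌋₊ : K)) =
      (∏ᶠ a ∈ S, f a)⁻¹ := by
    apply eq_inv_of_mul_eq_one_left
    rw [mul_right_comm, hfin, ← inv_div u, inv_pow]
    have : (u / (c : K)) ^ ⌊c⌋₊ ≠ 0 := pow_ne_zero _ (div_ne_zero hu hcK)
    field_simp
  rw [hI, mul_inv, one_div]

end Quotients

/-! ### Coordinates in a stacky fan -/

section Bar

variable {N : Type*} [AddCommGroup N]

theorem bar_add (a b : N) : bar (a + b) = bar a + bar b := TensorProduct.tmul_add _ _ _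

theorem bar_sub (a b : N) : bar (a - b) = bar a - bar b := TensorProduct.tmul_sub _ _ _

theorem bar_sum {ι : Type*} (s : Finset ι) (f : ι → N) : bar (∑ i ∈ s, f i) = ∑ i ∈ s, bar (f i) :=
  TensorProduct.tmul_sum _ _ _

theorem bar_zsmul (k : ℤ) (a : N) : bar (k • a) = (k : ℚ) • bar a := by
  rw [bar, bar, TensorProduct.tmul_smul, Int.cast_smul_eq_zsmul]

end Bar

namespace StackyFan

variable {N : Type*} [AddCommGroup N] {n : ℕ} {F : StackyFan N n} {σ σ' : Finset (Fin n)}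

theorem eq_of_sum_smul_ray_eq (hσ : σ ∈ F.cones) {a a' : Fin n → ℚ} (h : ∀ i, i ∉ σ → a i = 0)
    (h' : ∀ i, i ∉ σ → a' i = 0) (e : ∑ i, a i • F.ray i = ∑ i, a' i • F.ray i) : a = a' := by
  have h0 : ∑ i ∈ σ, (a i - a' i) • F.ray i = 0 := by
    rw [Finset.sum_subset (Finset.subset_univ σ)]
    · simp only [sub_smul, Finset.sum_sub_distrib, e, sub_self]
    · intro i _ hi
      rw [h i hi, h' i hi, sub_self, zero_smul]
  have hli : LinearIndepOn ℚ F.ray (σ : Set (Fin n)) := F.simplicial σ hσ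
  funext i
  by_cases hi : i ∈ σ
  · exact sub_eq_zero.1 (linearIndepOn_finset_iff.1 hli _ h0 i hi)
  · rw [h i hi, h' i hi]

/-- The point lies in both cones, hence in their common face. Both expansions agree with the one on
that face by simpliciality. -/
theorem eq_of_nonneg_of_sum_smul_ray_eq (hσ : σ ∈ F.cones) (hσ' : σ' ∈ F.cones)
    {a a' : Fin n → ℚ} (p : ∀ i, 0 ≤ a i) (p' : ∀ i, 0 ≤ a' i) (h : ∀ i, i ∉ σ → a i = 0)
    (h' : ∀ i, i ∉ σ' → a' i = 0) (e : ∑ i, a i • F.ray i = ∑ i, a' i • F.ray i) : a = a' := by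
  obtain ⟨x, -, hx, hxe⟩ := (Set.ext_iff.1 (F.inter_face σ hσ σ' hσ') (∑ i, a i • F.ray i)).1
    ⟨⟨a, p, h, rfl⟩, ⟨a', p', h', e⟩⟩
  have h1 : a = x := eq_of_sum_smul_ray_eq hσ h
    (fun i hi => hx i fun hm => hi (Finset.mem_inter.1 hm).1) hxe
  have h2 : a' = x := eq_of_sum_smul_ray_eq hσ' h'
    (fun i hi => hx i fun hm => hi (Finset.mem_inter.1 hm).2) (e.symm.trans hxe)
  rw [h1, h2]

theorem coord_eq (hσ : σ ∈ F.cones) {c : N} {a : Fin n → ℚ} (p : ∀ i, 0 ≤ a i)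
    (h : ∀ i, i ∉ σ → a i = 0) (e : bar c = ∑ i, a i • F.ray i) : F.coord c = a := by
  have hex : ∃ a : Fin n → ℚ, (∀ i, 0 ≤ a i) ∧ (∃ σ ∈ F.cones, ∀ i, i ∉ σ → a i = 0) ∧
      bar c = ∑ i, a i • F.ray i := ⟨a, p, ⟨σ, hσ, h⟩, e⟩
  obtain ⟨p', ⟨τ, hτ, h'⟩, e'⟩ := hex.choose_spec
  rw [coord, dif_pos hex]
  exact eq_of_nonneg_of_sum_smul_ray_eq hτ hσ p' p h' h (e'.symm.trans e)

theorem coord_spec {c : N} (hc : c ∈ F.suppSet) :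
    (∀ i, 0 ≤ F.coord c i) ∧ bar c = ∑ i, F.coord c i • F.ray i := by
  obtain ⟨τ, hτ, a, p, h, e⟩ := hc
  rw [coord_eq hτ p h e]
  exact ⟨p, e⟩

theorem coord_of_mem_boxOf (hσ : σ ∈ F.cones) {b : N} (hb : b ∈ F.boxOf σ) :
    (∀ i, 0 ≤ F.coord b i ∧ F.coord b i < 1) ∧ (∀ i, i ∉ σ → F.coord b i = 0) ∧
      bar b = ∑ i, F.coord b i • F.ray i := by
  obtain ⟨a, p, h, e⟩ := hb
  rw [coord_eq hσ (fun i => (p i).1) h e]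
  exact ⟨p, h, e⟩

theorem coord_hat (hσ : σ ∈ F.cones) {b : N} (hb : b ∈ F.boxOf σ) (i : Fin n) :
    F.coord (F.hat b) i = ⌈F.coord b i⌉ - F.coord b i := by
  obtain ⟨-, h, e⟩ := coord_of_mem_boxOf hσ hb
  have := coord_eq (F := F) hσ (c := F.hat b) (a := fun i => ⌈F.coord b i⌉ - F.coord b i)
    (fun i => sub_nonneg.2 (Int.le_ceil _)) (fun i hi => by simp [h i hi]) (by
      rw [hat, bar_sub, bar_sum]
      conv_lhs => rw [e]
      simp only [bar_zsmul, sub_smul, Finset.sum_sub_distrib]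
      rfl)
  rw [this]

theorem sum_zsmul_mem_sublattice {τ : Finset (Fin n)} {k : Fin n → ℤ} (h : ∀ i, i ∉ τ → k i = 0) :
    ∑ i, k i • F.ρ i ∈ F.sublattice τ := by
  refine AddSubgroup.sum_mem _ fun i _ => ?_
  by_cases hi : i ∈ τ
  · exact AddSubgroup.zsmul_mem _ (AddSubgroup.subset_closure (Set.mem_image_of_mem _ hi)) _
  · rw [h i hi, zero_smul]
    exact AddSubgroup.zero_mem _

theorem exists_of_mem_sublattice {τ : Finset (Fin n)} {c : N} (hc : c ∈ F.sublattice τ) :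
    ∃ k : Fin n → ℤ, (∀ i, i ∉ τ → k i = 0) ∧ c = ∑ i, k i • F.ρ i := by
  induction hc using AddSubgroup.closure_induction with
  | mem x hx =>
    obtain ⟨i, hi, rfl⟩ := hx
    refine ⟨fun k => if k = i then 1 else 0, fun k hk => if_neg ?_, by simp⟩
    rintro rfl
    exact hk hi
  | zero => exact ⟨0, by simp, by simp⟩
  | add x y _ _ hx hy =>
    obtain ⟨k, hk, rfl⟩ := hx
    obtain ⟨k', hk', rfl⟩ := hy
    exact ⟨k + k', fun i hi => by simp [hk i hi, hk' i hi], by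
      simp [add_smul, Finset.sum_add_distrib]⟩
  | neg x _ hx =>
    obtain ⟨k, hk, rfl⟩ := hx
    exact ⟨-k, fun i hi => by simp [hk i hi], by simp⟩

theorem sublattice_mono {τ τ' : Finset (Fin n)} (h : τ ⊆ τ') :
    F.sublattice τ ≤ F.sublattice τ' :=
  AddSubgroup.closure_mono (Set.image_mono (by exact_mod_cast h))

/-- The coordinates differ by integers strictly between `-1` and `1`. Torsion causes no ambiguity,
because the difference is an actual integral combination of the `ρ i` in `N`. -/
theorem eq_of_mem_boxOf (hσ : σ ∈ F.cones) {b b' : N} (hb : b ∈ F.boxOf σ) (hb' : b' ∈ F.boxOf σ)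
    (h : b - b' ∈ F.sublattice σ) : b = b' := by
  obtain ⟨k, hk, e⟩ := exists_of_mem_sublattice h
  obtain ⟨a, p, z, ea⟩ := hb
  obtain ⟨a', p', z', ea'⟩ := hb'
  have h1 : (fun i => a i - a' i) = fun i => (k i : ℚ) := by
    refine eq_of_sum_smul_ray_eq hσ (fun i hi => by simp [z i hi, z' i hi])
      (fun i hi => by simp [hk i hi]) ?_
    simp only [sub_smul, Finset.sum_sub_distrib, ← ea, ← ea', ← bar_sub, e, bar_sum, bar_zsmul]
    rfl
  have h2 : ∀ i, k i = 0 := by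
    intro i
    have h3 : a i - a' i = (k i : ℚ) := congrFun h1 i
    have h4 : (k i : ℚ) < 1 := by linarith [(p i).2, (p' i).1]
    have h5 : (-1 : ℚ) < k i := by linarith [(p i).1, (p' i).2]
    have h6 : k i < 1 := by exact_mod_cast h4
    have h7 : -1 < k i := by exact_mod_cast h5
    omega
  rw [← sub_eq_zero, e]
  exact Finset.sum_eq_zero fun i _ => by rw [h2 i, zero_smul]

theorem boxOf_subset_box (hσ : σ ∈ F.cones) : F.boxOf σ ⊆ F.box := fun _ hb => ⟨σ, hσ, hb⟩

theorem mem_boxOf_of_mem_box (hσ : σ ∈ F.cones) {b : N} (hb : b ∈ F.box) (hc : bar b ∈ F.cone σ) :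
    b ∈ F.boxOf σ := by
  obtain ⟨τ, hτ, a, p, z, e⟩ := hb
  obtain ⟨a', p', z', e'⟩ := hc
  have := eq_of_nonneg_of_sum_smul_ray_eq hτ hσ (fun i => (p i).1) p' z z' (e.symm.trans e')
  exact ⟨a, p, fun i hi => by rw [this, z' i hi], e⟩

theorem IsTop.weight_eq_zero (hσ : F.IsTop σ) {i : Fin n} (hi : i ∉ σ) : F.weight σ i = 0 := by
  apply hσ.dual_ext
  intro k hk
  rw [hσ.weight_ray i hk, if_neg (fun h : k = i => hi (h ▸ hk)), LinearMap.zero_apply]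

theorem IsTop.u_eq_zero (hσ : F.IsTop σ) {i : Fin n} (hi : i ∉ σ) : F.u σ i = 0 := by
  rw [u, hσ.weight_eq_zero hi, map_zero]

theorem IsTop.weight_sum (hσ : F.IsTop σ) (i : Fin n) {a : Fin n → ℚ} (h : ∀ i, i ∉ σ → a i = 0) :
    F.weight σ i (∑ k, a k • F.ray k) = a i := by
  rw [map_sum, ← Finset.sum_subset (Finset.subset_univ σ)
    (fun k _ hk => by rw [h k hk, zero_smul, map_zero])]
  have : ∀ k ∈ σ, F.weight σ i (a k • F.ray k) = if k = i then a k else 0 := by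
    intro k hk
    rw [map_smul, hσ.weight_ray i hk, smul_eq_mul, mul_ite, mul_one, mul_zero]
  rw [Finset.sum_congr rfl this, Finset.sum_ite_eq']
  split_ifs with hi
  · rfl
  · rw [h i hi]

theorem IsTop.exists_coord (hσ : F.IsTop σ) (x : NQ N) :
    ∃ a : Fin n → ℚ, (∀ i, i ∉ σ → a i = 0) ∧ x = ∑ i, a i • F.ray i := by
  have hx : x ∈ Submodule.span ℚ (F.ray '' (σ : Set (Fin n))) := by rw [hσ.2]; trivial
  induction hx using Submodule.span_induction with
  | mem x hx =>
    obtain ⟨i, hi, rfl⟩ := hx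
    refine ⟨fun k => if k = i then 1 else 0, fun k hk => if_neg ?_, by simp⟩
    rintro rfl
    exact hk hi
  | zero => exact ⟨0, by simp, by simp⟩
  | add x y _ _ hx hy =>
    obtain ⟨a, ha, rfl⟩ := hx
    obtain ⟨a', ha', rfl⟩ := hy
    exact ⟨a + a', fun i hi => by simp [ha i hi, ha' i hi], by
      simp [add_smul, Finset.sum_add_distrib]⟩
  | smul q x _ hx =>
    obtain ⟨a, ha, rfl⟩ := hx
    exact ⟨q • a, fun i hi => by simp [ha i hi], by simp [Finset.smul_sum, mul_smul]⟩

/-! ### The curve that connects adjacent fixed points -/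

namespace Adjacent

variable {j j' : Fin n} (h : F.Adjacent σ σ' j j')
include h

theorem mem_left : j ∈ σ ∧ j ∉ σ' := Finset.mem_sdiff.1 (by rw [h.left_diff]; simp)

theorem mem_right : j' ∈ σ' ∧ j' ∉ σ := Finset.mem_sdiff.1 (by rw [h.right_diff]; simp)

theorem mem_right_of_mem_left {i : Fin n} (hi : i ∈ σ) (hj : i ≠ j) : i ∈ σ' := by
  by_contra hi'
  have : i ∈ σ \ σ' := Finset.mem_sdiff.2 ⟨hi, hi'⟩
  rw [h.left_diff, Finset.mem_singleton] at this
  exact hj this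

theorem mem_left_of_mem_right {i : Fin n} (hi : i ∈ σ') (hj : i ≠ j') : i ∈ σ := by
  by_contra hi'
  have : i ∈ σ' \ σ := Finset.mem_sdiff.2 ⟨hi, hi'⟩
  rw [h.right_diff, Finset.mem_singleton] at this
  exact hj this

theorem ne : j ≠ j' := fun e => h.mem_right.2 (e ▸ h.mem_left.1)

theorem curveDegree_spec (c : ℚ) : F.curveDegree σ σ' j c j = c ∧
    (∀ i, i ∉ σ ∪ σ' → F.curveDegree σ σ' j c i = 0) ∧
      ∑ i, F.curveDegree σ σ' j c i • F.ray i = 0 := by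
  have hex : ∃ d : Fin n → ℚ, d j = c ∧ (∀ i, i ∉ σ ∪ σ' → d i = 0) ∧
      ∑ i, d i • F.ray i = 0 := by
    obtain ⟨a, ha, e⟩ := h.right.exists_coord (F.ray j)
    -- This is `c` times the relation that expands `ρ̄ j` in the basis of `σ'`.
    refine ⟨fun i => c * ((if i = j then 1 else 0) - a i), ?_, ?_, ?_⟩
    · simp [ha j h.mem_left.2]
    · intro i hi
      rw [Finset.mem_union, not_or] at hi
      dsimp only
      rw [if_neg (fun hij : i = j => hi.1 (hij ▸ h.mem_left.1)), ha i hi.2, sub_zero, mul_zero]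
    · simp only [mul_smul, sub_smul, ← Finset.smul_sum, Finset.sum_sub_distrib, ← e]
      simp
  rw [curveDegree, dif_pos hex]
  exact hex.choose_spec

/-- The rays `j` and `j'` lie on opposite sides of the wall. Otherwise, moving the `j'` term across
and adding a large multiple of the rays of the wall gives one point with nonnegative expansions in
both `σ` and `σ'`. Uniqueness then forces the coefficient `c` of `ρ̄ j` to vanish. -/
theorem curveDegree_pos {c : ℚ} (hc : 0 < c) : 0 < F.curveDegree σ σ' j c j' := by
  obtain ⟨hj, hz, hr⟩ := h.curveDegree_spec c
  set l := F.curveDegree σ σ' j c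
  by_contra hneg
  rw [not_lt] at hneg
  set M : ℚ := ∑ i, |l i|
  have hM : ∀ i, 0 ≤ l i + M := fun i => by
    have h1 : |l i| ≤ M :=
      Finset.single_le_sum (f := fun i => |l i|) (fun i _ => abs_nonneg _) (Finset.mem_univ i)
    linarith [neg_abs_le (l i)]
  have hM0 : 0 ≤ M := Finset.sum_nonneg fun i _ => abs_nonneg _
  have hsum : ∀ i, l i • F.ray i + ((if i ∈ σ ∩ σ' then M else 0) -
      (if i = j' then l i else 0)) • F.ray i =
      (if i = j' then 0 else l i + if i ∈ σ ∩ σ' then M else 0) • F.ray i := by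
    intro i
    rw [← add_smul]
    congr 1
    by_cases hi : i = j'
    · subst hi
      simp [h.mem_right.2]
    · simp [hi]
  have key := eq_of_nonneg_of_sum_smul_ray_eq (F := F) h.left.1 h.right.1
    (a := fun i => if i = j' then 0 else l i + if i ∈ σ ∩ σ' then M else 0)
    (a' := fun i => (if i ∈ σ ∩ σ' then M else 0) - (if i = j' then l i else 0)) ?_ ?_ ?_ ?_ ?_
  · have := congrFun key j
    simp only [h.ne, if_false, Finset.mem_inter, h.mem_left.2, and_false, hj] at this
    linarith
  · intro i
    split_ifs with h1 h2
    · exact le_rfl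
    · exact hM i
    · rw [add_zero]
      by_cases hij : i = j
      · rw [hij, hj]; exact hc.le
      · by_cases hi : i ∈ σ ∪ σ'
        · exfalso
          rcases Finset.mem_union.1 hi with hi | hi
          · exact h2 (Finset.mem_inter.2 ⟨hi, h.mem_right_of_mem_left hi hij⟩)
          · exact h2 (Finset.mem_inter.2 ⟨h.mem_left_of_mem_right hi h1, hi⟩)
        · rw [hz i hi]
  · intro i
    split_ifs with h1 h2 h2
    · rw [h2]; linarith
    · linarith
    · rw [h2]; linarith
    · simp
  · intro i hi
    split_ifs with h1 h2
    · rfl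
    · exact absurd (Finset.mem_inter.1 h2).1 hi
    · rw [add_zero]
      exact hz i fun hm => (Finset.mem_union.1 hm).elim hi
        fun hm => hi (h.mem_left_of_mem_right hm h1)
  · intro i hi
    have h1 : i ≠ j' := fun e => hi (e ▸ h.mem_right.1)
    have h2 : i ∉ σ ∩ σ' := fun hm => hi (Finset.mem_inter.1 hm).2
    simp [h1, h2]
  · rw [← Finset.sum_congr rfl fun i _ => hsum i, Finset.sum_add_distrib, hr, zero_add]

/-- It suffices to compare on the rays of `σ'`. Only `ρ̄ j'` is new, and applying the weights of `σ`
to the relation `l` gives their values on it. -/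
theorem weight_right {c : ℚ} (hc : 0 < c) (i : Fin n) : F.weight σ' i =
    F.weight σ i - (F.curveDegree σ σ' j c i / c) • F.weight σ j := by
  obtain ⟨hj, hz, hr⟩ := h.curveDegree_spec c
  have hpos := h.curveDegree_pos hc
  set l := F.curveDegree σ σ' j c
  have hw : ∀ i, (if i = j' then 0 else l i) + l j' * F.weight σ i (F.ray j') = 0 := by
    intro i
    have h1 : ∑ k, l k • F.ray k =
        (∑ k, (if k = j' then 0 else l k) • F.ray k) + l j' • F.ray j' := by
      rw [← Finset.sum_erase_add _ _ (Finset.mem_univ j'),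
        ← Finset.sum_erase_add _ (fun k => (if k = j' then 0 else l k) • F.ray k)
          (Finset.mem_univ j'), if_pos rfl, zero_smul,
        add_zero]
      congr 1
      exact Finset.sum_congr rfl fun k hk => by rw [if_neg (Finset.ne_of_mem_erase hk)]
    have h2 := h.left.weight_sum i (a := fun k => if k = j' then 0 else l k) (by
      intro k hk
      split_ifs with hkj
      · rfl
      · exact hz k fun hm => (Finset.mem_union.1 hm).elim hk
          fun hm => hk (h.mem_left_of_mem_right hm hkj))
    rw [← h2, ← smul_eq_mul, ← map_smul, ← map_add, ← h1, hr, map_zero]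
  apply h.right.dual_ext
  intro k hk
  rw [h.right.weight_ray i hk, LinearMap.sub_apply, LinearMap.smul_apply, smul_eq_mul]
  by_cases hkj : k = j'
  · subst hkj
    have h1 := hw i
    have h2 := hw j
    rw [if_neg h.ne, hj] at h2
    have h3 : F.weight σ j (F.ray k) = -c / l k := by
      rw [eq_div_iff hpos.ne']
      linarith
    rw [h3]
    by_cases hik : i = k
    · subst hik
      rw [if_pos rfl, zero_add] at h1
      rw [(mul_eq_zero.1 h1).resolve_left hpos.ne', if_pos rfl]
      field_simp
      ring
    · rw [if_neg hik] at h1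
      have h4 : F.weight σ i (F.ray k) = -l i / l k := by
        rw [eq_div_iff hpos.ne']
        linarith
      rw [h4, if_neg (fun e => hik e.symm)]
      field_simp
      ring
  · have hk' := h.mem_left_of_mem_right hk hkj
    rw [h.left.weight_ray i hk', h.left.weight_ray j hk',
      if_neg (fun e => h.mem_left.2 (e ▸ hk) : k ≠ j)]
    simp

/-- The change of weights, read at the pole `z = -u_j(σ)/c`, is a shift by `l_i z`. The whole
comparison of the two fixed points rests on this. -/
theorem u_right {c : ℚ} (hc : 0 < c) (i : Fin n) : F.u σ' i =
    F.u σ i + (F.curveDegree σ σ' j c i : ST N) * (-(F.u σ j) / (c : ST N)) := by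
  rw [u, h.weight_right hc i, map_sub, charST_smul]
  simp only [u]
  push_cast
  ring

theorem pole_ne_zero {c : ℚ} (hc : 0 < c) : -(F.u σ j) / (c : ST N) ≠ 0 :=
  div_ne_zero (neg_ne_zero.2 (h.left.u_ne_zero h.mem_left.1)) (by exact_mod_cast hc.ne')

/-- The left side is a character with the value `1` on `ρ̄ i`. -/
theorem u_add_ne_zero {c : ℚ} {i : Fin n} (hi : i ∈ σ) (hij : i ≠ j) (a : ℚ) :
    F.u σ i + (a : ST N) * (-(F.u σ j) / (c : ST N)) ≠ 0 := by
  have h1 : F.u σ i + (a : ST N) * (-(F.u σ j) / (c : ST N)) =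
      charST (F.weight σ i - (a / c) • F.weight σ j) := by
    rw [map_sub, charST_smul, u, u]
    push_cast
    ring
  rw [h1]
  apply charST_ne_zero
  intro h0
  have := congrArg (fun φ => φ (F.ray i)) h0
  simp only [LinearMap.sub_apply, LinearMap.smul_apply, h.left.weight_ray _ hi, if_neg hij,
    LinearMap.zero_apply] at this
  simp at this

theorem u_left_add_ne_zero {c : ℚ} (hc : 0 < c) (i : Fin n) {a : ℚ} (ha : 0 < a)
    (hac : i = j → a ≠ c) : F.u σ i + (a : ST N) * (-(F.u σ j) / (c : ST N)) ≠ 0 := by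
  have hcK : (c : ST N) ≠ 0 := by exact_mod_cast hc.ne'
  by_cases hij : i = j
  · subst hij
    have h1 : F.u σ i + (a : ST N) * (-(F.u σ i) / (c : ST N)) =
        F.u σ i * (((c - a : ℚ) : ST N) / c) := by
      push_cast
      field_simp
      ring
    rw [h1]
    refine mul_ne_zero (h.left.u_ne_zero h.mem_left.1) (div_ne_zero ?_ hcK)
    exact_mod_cast sub_ne_zero.2 (hac rfl).symm
  · by_cases hi : i ∈ σ
    · exact h.u_add_ne_zero hi hij a
    · rw [h.left.u_eq_zero hi, zero_add]
      exact mul_ne_zero (by exact_mod_cast ha.ne') (h.pole_ne_zero hc)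

/-- This gives regularity at `σ'`. For `i = j'` the expression is `(l_{j'} + a) z`, and `l_{j'} > 0`
excludes a pole. -/
theorem u_right_add_ne_zero {c : ℚ} (hc : 0 < c) (i : Fin n) {a : ℚ} (ha : 0 < a) :
    F.u σ' i + (a : ST N) * (-(F.u σ j) / (c : ST N)) ≠ 0 := by
  by_cases hi : i ∈ σ'
  · have h1 : F.u σ' i + (a : ST N) * (-(F.u σ j) / (c : ST N)) = F.u σ i +
        ((F.curveDegree σ σ' j c i + a : ℚ) : ST N) * (-(F.u σ j) / (c : ST N)) := by
      rw [h.u_right hc i]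
      push_cast
      ring
    by_cases hij : i = j'
    · subst hij
      rw [h1, h.left.u_eq_zero h.mem_right.2, zero_add]
      refine mul_ne_zero ?_ (h.pole_ne_zero hc)
      exact_mod_cast (add_pos (h.curveDegree_pos hc) ha).ne'
    · rw [h1]
      exact h.u_add_ne_zero (h.mem_left_of_mem_right hi hij) (fun e => h.mem_left.2 (e ▸ hi)) _
  · rw [h.right.u_eq_zero hi, zero_add]
    exact mul_ne_zero (by exact_mod_cast ha.ne') (h.pole_ne_zero hc)

/-! ### The opposite box element -/

theorem isInt_coord_add {b : N} (hb : b ∈ F.boxOf σ) {c : ℚ}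
    (hcb : Int.fract c = F.coord (F.hat b) j) :
    F.coord b j + c = (⌈F.coord b j⌉ + ⌊c⌋ : ℤ) := by
  rw [coord_hat h.left.1 hb, ← Int.self_sub_floor] at hcb
  push_cast
  linarith

/-- Adding the relation `l` does not change `b̄`, and subtracting integral parts leaves fractional
parts. The coordinate at `j` disappears because `b_j + c` is an integer. -/
theorem bar_oppositeBox {b : N} (hb : b ∈ F.boxOf σ) {c : ℚ}
    (hcb : Int.fract c = F.coord (F.hat b) j) :
    (∀ i, i ∉ σ' → Int.fract (F.coord b i + F.curveDegree σ σ' j c i) = 0) ∧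
      bar (b - ∑ i, ⌊F.coord b i + F.curveDegree σ σ' j c i⌋ • F.ρ i) =
        ∑ i, Int.fract (F.coord b i + F.curveDegree σ σ' j c i) • F.ray i := by
  obtain ⟨hj, hz, hr⟩ := h.curveDegree_spec c
  obtain ⟨p, z, e⟩ := coord_of_mem_boxOf h.left.1 hb
  constructor
  · intro i hi
    by_cases hij : i = j
    · rw [hij, hj, h.isInt_coord_add hb hcb, Int.fract_intCast]
    · have hi' : i ∉ σ := fun hm => hi (h.mem_right_of_mem_left hm hij)
      rw [z i hi', hz i (by simp [hi, hi']), add_zero, Int.fract_zero]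
  · rw [bar_sub, bar_sum]
    simp only [bar_zsmul, ← Int.self_sub_floor, sub_smul, add_smul, Finset.sum_sub_distrib,
      Finset.sum_add_distrib, hr, ← e, add_zero]
    rfl

theorem oppositeBox_mem {b : N} (hb : b ∈ F.boxOf σ) {c : ℚ}
    (hcb : Int.fract c = F.coord (F.hat b) j) :
    b - ∑ i, ⌊F.coord b i + F.curveDegree σ σ' j c i⌋ • F.ρ i ∈ F.boxOf σ' :=
  ⟨_, fun _ => ⟨Int.fract_nonneg _, Int.fract_lt_one _⟩, (h.bar_oppositeBox hb hcb).1,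
    (h.bar_oppositeBox hb hcb).2⟩

theorem coord_oppositeBox {b : N} (hb : b ∈ F.boxOf σ) {c : ℚ}
    (hcb : Int.fract c = F.coord (F.hat b) j) (i : Fin n) :
    F.coord (b - ∑ i, ⌊F.coord b i + F.curveDegree σ σ' j c i⌋ • F.ρ i) i =
      Int.fract (F.coord b i + F.curveDegree σ σ' j c i) :=
  congrFun (coord_eq h.right.1 (fun _ => Int.fract_nonneg _) (h.bar_oppositeBox hb hcb).1
    (h.bar_oppositeBox hb hcb).2) i

/-- Two solutions differ by an element of `N_{σ'}`, whatever their multiples of `ρ j'` are, so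
`eq_of_mem_boxOf` gives uniqueness. -/
theorem isOpposite_iff {b : N} (hb : b ∈ F.boxOf σ) {c : ℚ} (hc : 0 < c)
    (hcb : Int.fract c = F.coord (F.hat b) j) (b' : N) :
    F.IsOpposite σ σ' j j' b c b' ↔
      b' = b - ∑ i, ⌊F.coord b i + F.curveDegree σ σ' j c i⌋ • F.ρ i := by
  obtain ⟨hj, hz, hr⟩ := h.curveDegree_spec c
  obtain ⟨p, z, e⟩ := coord_of_mem_boxOf h.left.1 hb
  set b₀ := b - ∑ i, ⌊F.coord b i + F.curveDegree σ σ' j c i⌋ • F.ρ i with hb₀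
  have hpos := h.curveDegree_pos hc
  -- The choice `q' = ⌊l_{j'}⌋` cancels the coefficient of `ρ j'`; that of `ρ j` cancels since `⌊b_j
  -- + c⌋ = ⌈b_j⌉ + ⌊c⌋`.
  have hmem : F.hat b + ⌊c⌋ • F.ρ j + ⌊F.curveDegree σ σ' j c j'⌋₊ • F.ρ j' + b₀ ∈
      F.sublattice (σ ∩ σ') := by
    have h1 : F.hat b + ⌊c⌋ • F.ρ j + ⌊F.curveDegree σ σ' j c j'⌋₊ • F.ρ j' + b₀ =
        ∑ i, (⌈F.coord b i⌉ - ⌊F.coord b i + F.curveDegree σ σ' j c i⌋ +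
          (if i = j then ⌊c⌋ else 0) +
          (if i = j' then ⌊F.curveDegree σ σ' j c j'⌋ else 0)) • F.ρ i := by
      simp only [add_smul, sub_smul, Finset.sum_add_distrib, Finset.sum_sub_distrib, ite_smul,
        zero_smul, Finset.sum_ite_eq', Finset.mem_univ, if_true]
      rw [← natCast_zsmul, Int.natCast_floor_eq_floor hpos.le, hb₀, hat]
      abel
    rw [h1]
    apply sum_zsmul_mem_sublattice
    intro i hi
    by_cases hij : i = j
    · subst hij
      rw [if_pos rfl, if_neg h.ne, hj, h.isInt_coord_add hb hcb, Int.floor_intCast]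
      ring
    · by_cases hij' : i = j'
      · subst hij'
        rw [if_neg hij, if_pos rfl, z i h.mem_right.2]
        simp
      · have hi' : i ∉ σ := fun hm =>
          hi (Finset.mem_inter.2 ⟨hm, h.mem_right_of_mem_left hm hij⟩)
        have hi'' : i ∉ σ' := fun hm => hi' (h.mem_left_of_mem_right hm hij')
        simp [hij, hij', z i hi', hz i (by simp [hi', hi''])]
  have hbox := h.oppositeBox_mem hb hcb
  constructor
  · rintro ⟨hb', q, hq⟩
    refine eq_of_mem_boxOf h.right.1 hb' hbox ?_
    have h2 := sublattice_mono (Finset.inter_subset_right) (AddSubgroup.sub_mem _ hq hmem)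
    have h3 : F.ρ j' ∈ F.sublattice σ' := AddSubgroup.subset_closure ⟨j', h.mem_right.1, rfl⟩
    have h4 : b' - b₀ = (F.hat b + ⌊c⌋ • F.ρ j + q • F.ρ j' + b' -
        (F.hat b + ⌊c⌋ • F.ρ j + ⌊F.curveDegree σ σ' j c j'⌋₊ • F.ρ j' + b₀)) -
        q • F.ρ j' + ⌊F.curveDegree σ σ' j c j'⌋₊ • F.ρ j' := by abel
    rw [h4]
    exact AddSubgroup.add_mem _ (AddSubgroup.sub_mem _ h2 (AddSubgroup.nsmul_mem _ h3 _))
      (AddSubgroup.nsmul_mem _ h3 _)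
  · rintro rfl
    exact ⟨hbox, _, hmem⟩

end Adjacent

end StackyFan

/-! ### Exponential series -/

theorem sum_antidiagonal_prod {R : Type*} [CommRing R] {n : ℕ} (e : Fin n →₀ ℕ)
    (f : Fin n → ℕ × ℕ → R) :
    ∑ p ∈ Finset.HasAntidiagonal.antidiagonal e, ∏ i, f i (p.1 i, p.2 i) =
      ∏ i, ∑ p ∈ Finset.HasAntidiagonal.antidiagonal (e i), f i p := by
  rw [Finset.prod_univ_sum]
  refine Finset.sum_bij' (fun p _ i => (p.1 i, p.2 i))
    (fun r _ => (Finsupp.equivFunOnFinite.symm fun i => (r i).1,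
      Finsupp.equivFunOnFinite.symm fun i => (r i).2)) ?_ ?_ ?_ ?_ ?_
  · intro p hp
    rw [Finset.HasAntidiagonal.mem_antidiagonal] at hp
    rw [Fintype.mem_piFinset]
    intro i
    rw [Finset.HasAntidiagonal.mem_antidiagonal, ← hp]
    rfl
  · intro r hr
    rw [Fintype.mem_piFinset] at hr
    rw [Finset.HasAntidiagonal.mem_antidiagonal]
    ext i
    exact Finset.HasAntidiagonal.mem_antidiagonal.1 (hr i)
  · intro p _
    ext <;> rfl
  · intro r _
    rfl
  · intro p _
    rfl

/-- The binomial theorem in each variable. It merges the two exponentials of the I-function into one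
with exponents `u_i/z + d_i`. -/
theorem expT_add {K R : Type*} [Field K] [CharZero K] [CommRing R] [Algebra K R] {n : ℕ}
    (v w : Fin n → R) : expT K v * expT K w = expT K (fun i => v i + w i) := by
  ext e
  rw [MvPowerSeries.coeff_mul]
  have hc : ∀ (w : Fin n → R) (e : Fin n →₀ ℕ), MvPowerSeries.coeff e (expT K w) =
      ∏ i, algebraMap K R ((Nat.factorial (e i) : K)⁻¹) * w i ^ e i := fun _ _ => rfl
  simp only [hc, ← Finset.prod_mul_distrib]
  rw [sum_antidiagonal_prod e fun i p => algebraMap K R ((Nat.factorial p.1 : K)⁻¹) * v i ^ p.1 *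
    (algebraMap K R ((Nat.factorial p.2 : K)⁻¹) * w i ^ p.2)]
  refine Finset.prod_congr rfl fun i _ => ?_
  rw [(Commute.all (v i) (w i)).add_pow', Finset.mul_sum]
  refine Finset.sum_congr rfl fun p hp => ?_
  rw [Finset.HasAntidiagonal.mem_antidiagonal] at hp
  have h1 : ((Nat.factorial p.1 : K)⁻¹) * ((Nat.factorial p.2 : K)⁻¹) =
      (Nat.factorial (e i) : K)⁻¹ * (Nat.choose (e i) p.1 : K) := by
    have h2 : (Nat.choose (e i) p.1 : K) * (Nat.factorial p.1 : K) * (Nat.factorial p.2 : K) =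
        (Nat.factorial (e i) : K) := by
      rw [← hp, Nat.choose_symm_add]
      exact_mod_cast Nat.add_choose_mul_factorial_mul_factorial p.1 p.2
    have hf : ∀ k : ℕ, (Nat.factorial k : K) ≠ 0 := fun k => by
      exact_mod_cast Nat.factorial_ne_zero k
    have := hf p.1
    have := hf p.2
    have := hf (e i)
    rw [← h2] at this ⊢
    field_simp
    rw [div_self (fun h0 => this (by rw [h0, zero_mul, zero_mul]))]
  have h3 := congrArg (algebraMap K R) h1
  rw [map_mul, map_mul, map_natCast] at h3
  rw [nsmul_eq_mul, mul_mul_mul_comm, h3, mul_assoc]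

namespace StackyFan

variable {N : Type*} [AddCommGroup N] {n : ℕ} {F : StackyFan N n} {σ : Finset (Fin n)}

/-! ### Relations and units in Chen-Ruan cohomology -/

theorem mk_eq_zero {p : MvPolynomial N (STz N)} (h : F.CRRel p) :
    (Ideal.Quotient.mk F.crIdeal p : F.CR) = 0 :=
  Ideal.Quotient.eq_zero_iff_mem.2 (Ideal.subset_span h)

theorem y_mul_of_commonCone {c₁ c₂ : N} (h : F.CommonCone c₁ c₂) :
    F.y c₁ * F.y c₂ = F.y (c₁ + c₂) := by
  have := mk_eq_zero (CRRel.mul c₁ c₂ h)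
  rw [map_sub, map_mul] at this
  exact sub_eq_zero.1 this

theorem y_mul_of_not_commonCone {c₁ c₂ : N} (h : ¬ F.CommonCone c₁ c₂) :
    F.y c₁ * F.y c₂ = 0 := by
  have := mk_eq_zero (CRRel.mul_zero c₁ c₂ h)
  rwa [map_mul] at this

theorem y_zero : F.y 0 = 1 := by
  have := mk_eq_zero (F := F) CRRel.one
  rw [map_sub, map_one] at this
  exact sub_eq_zero.1 this

theorem algebraMap_charST (χ : Module.Dual ℚ (NQ N)) :
    algebraMap (STz N) F.CR (RatFunc.C (charST χ)) =
      ∑ i, algebraMap (STz N) F.CR ((χ (F.ray i) : ℚ) : STz N) * F.y (F.ρ i) := by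
  have := mk_eq_zero (F := F) (CRRel.linear χ)
  rw [map_sub, map_sum] at this
  simp only [map_mul] at this
  exact sub_eq_zero.1 this

theorem subset_of_sum_mem_cone {τ : Finset (Fin n)} (hτ : τ ∈ F.cones) (hσ : σ ∈ F.cones)
    (h : bar (∑ i ∈ τ, F.ρ i) ∈ F.cone σ) : τ ⊆ σ := by
  obtain ⟨a, p, z, e⟩ := h
  have h1 : bar (∑ i ∈ τ, F.ρ i) = ∑ i, (if i ∈ τ then (1 : ℚ) else 0) • F.ray i := by
    rw [bar_sum]
    simp only [ite_smul, one_smul, zero_smul, Finset.sum_ite_mem, Finset.univ_inter]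
    rfl
  have h2 := eq_of_nonneg_of_sum_smul_ray_eq hτ hσ
    (a := fun i => if i ∈ τ then (1 : ℚ) else 0) (fun i => by split_ifs <;> norm_num) p
    (fun i hi => if_neg hi) z (h1.symm.trans e)
  intro i hi
  by_contra hi'
  have := congrFun h2 i
  simp [hi, z i hi'] at this

/-- Stanley-Reisner relations: any cone containing the sum of the rays of `τ` contains `τ`, so each
further nonzero product enlarges the cone. -/
theorem prod_y_ne_zero {τ : Finset (Fin n)} (h : ∏ i ∈ τ, F.y (F.ρ i) ≠ 0) :
    τ ∈ F.cones ∧ ∏ i ∈ τ, F.y (F.ρ i) = F.y (∑ i ∈ τ, F.ρ i) := by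
  induction τ using Finset.induction_on with
  | empty => exact ⟨F.empty_mem, by simp [y_zero]⟩
  | insert k τ hk ih =>
    rw [Finset.prod_insert hk] at h
    obtain ⟨hτ, e⟩ := ih (right_ne_zero_of_mul h)
    rw [e] at h
    by_cases hc : F.CommonCone (F.ρ k) (∑ i ∈ τ, F.ρ i)
    · refine ⟨?_, ?_⟩
      · obtain ⟨σ, hσ, h1, h2⟩ := hc
        refine F.face_mem σ hσ _ (Finset.insert_subset ?_ (subset_of_sum_mem_cone hτ hσ h2))
        exact (ray_mem_cone_iff hσ k).1 h1
      · rw [Finset.prod_insert hk, Finset.sum_insert hk, e, y_mul_of_commonCone hc]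
    · exact absurd (y_mul_of_not_commonCone hc) h

theorem isTop_of_forall_dual (hσ : σ ∈ F.cones)
    (h : ∀ χ : Module.Dual ℚ (NQ N), (∀ i ∈ σ, χ (F.ray i) = 0) → χ = 0) : F.IsTop σ := by
  refine ⟨hσ, ?_⟩
  by_contra hne
  obtain ⟨χ, hχ, hle⟩ := Submodule.exists_le_ker_of_lt_top _ (lt_top_iff_ne_top.2 hne)
  exact hχ (h χ fun i hi => hle (Submodule.subset_span ⟨i, hi, rfl⟩))

/-- Modulo a prime ideal, the classes `u_i` agree with their restrictions to a fixed point. -/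
theorem exists_isTop_sub_mem (P : Ideal F.CR) [P.IsPrime] : ∃ τ, F.IsTop τ ∧
    ∀ i, F.y (F.ρ i) - algebraMap (STz N) F.CR (RatFunc.C (F.u τ i)) ∈ P := by
  -- By primality the product over `τ` is not in `P`, in particular not zero, so `τ` is a cone.
  set τ : Finset (Fin n) := Finset.univ.filter fun i => F.y (F.ρ i) ∉ P with hτ
  have hout : ∀ i, i ∉ τ → F.y (F.ρ i) ∈ P := by
    intro i hi
    by_contra h
    exact hi (by simp [hτ, h])
  have hprod : ∏ i ∈ τ, F.y (F.ρ i) ∉ P := by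
    intro h
    obtain ⟨i, hi, hiP⟩ := (Ideal.IsPrime.prod_mem_iff).1 h
    exact (Finset.mem_filter.1 hi).2 hiP
  have hcone := (prod_y_ne_zero fun h0 => hprod (h0 ▸ P.zero_mem)).1
  have hlin : ∀ χ : Module.Dual ℚ (NQ N), algebraMap (STz N) F.CR (RatFunc.C (charST χ)) -
      ∑ i ∈ τ, algebraMap (STz N) F.CR ((χ (F.ray i) : ℚ) : STz N) * F.y (F.ρ i) ∈ P := by
    intro χ
    rw [algebraMap_charST, ← Finset.sum_sdiff (Finset.subset_univ τ), add_sub_cancel_right]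
    exact Ideal.sum_mem _ fun i hi => Ideal.mul_mem_left _ _ (hout i (Finset.mem_sdiff.1 hi).2)
  -- A nonzero character vanishing on `τ` would lie in `P` by the linear relation, yet it is a unit
  -- in the localized ring.
  have htop : F.IsTop τ := by
    refine isTop_of_forall_dual hcone fun χ hχ => ?_
    by_contra hne
    have h1 := hlin χ
    rw [Finset.sum_eq_zero (fun i hi => by rw [hχ i hi, Rat.cast_zero, map_zero, zero_mul]),
      sub_zero] at h1
    refine Ideal.IsPrime.ne_top ‹_› (Ideal.eq_top_of_isUnit_mem _ h1 ?_)
    apply IsUnit.map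
    rw [isUnit_iff_ne_zero, Ne, map_eq_zero]
    exact charST_ne_zero hne
  refine ⟨τ, htop, fun i => ?_⟩
  by_cases hi : i ∈ τ
  · have h1 := hlin (F.weight τ i)
    have h2 : ∑ k ∈ τ, algebraMap (STz N) F.CR ((F.weight τ i (F.ray k) : ℚ) : STz N) *
        F.y (F.ρ k) = F.y (F.ρ i) := by
      rw [Finset.sum_eq_single i]
      · rw [htop.weight_ray i hi, if_pos rfl, Rat.cast_one, map_one, one_mul]
      · intro k hk hki
        rw [htop.weight_ray i hk, if_neg hki, Rat.cast_zero, map_zero, zero_mul]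
      · exact fun h => absurd hi h
    rw [h2] at h1
    rw [← neg_sub]
    exact P.neg_mem h1
  · rw [htop.u_eq_zero hi, map_zero, map_zero, sub_zero]
    exact hout i hi

theorem C_add_mul_X_ne_zero (x : ST N) {a : ℚ} (ha : a ≠ 0) :
    (RatFunc.C x + (a : STz N) * RatFunc.X : STz N) ≠ 0 := by
  have h1 : (RatFunc.C x + (a : STz N) * RatFunc.X : STz N) = algebraMap (Polynomial (ST N)) (STz N)
      (Polynomial.C (a : ST N) * Polynomial.X + Polynomial.C x) := by
    rw [map_add, map_mul, RatFunc.algebraMap_C, RatFunc.algebraMap_C, RatFunc.algebraMap_X,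
      map_ratCast, add_comm]
  rw [h1]
  apply RatFunc.algebraMap_ne_zero
  intro h0
  have := congrArg (fun p => Polynomial.coeff p 1) h0
  simp [Polynomial.coeff_C, ha] at this

/-- Modulo a maximal ideal the class becomes a nonzero scalar of the form `u_i(τ) + a z`, so no
maximal ideal contains it. -/
theorem isUnit_uCR_add {m : ℕ} (i : Fin n ⊕ Fin m) {a : ℚ} (ha : a ≠ 0) :
    IsUnit (F.uCR i + algebraMap (STz N) F.CR ((a : STz N) * RatFunc.X)) := by
  cases i with
  | inl i =>
    by_contra hu
    obtain ⟨P, hP, hmem⟩ := exists_max_ideal_of_mem_nonunits hu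
    have := hP.isPrime
    obtain ⟨τ, -, h1⟩ := exists_isTop_sub_mem P
    have h2 := P.sub_mem hmem (h1 i)
    have h3 : F.uCR (Sum.inl i : Fin n ⊕ Fin m) +
        algebraMap (STz N) F.CR ((a : STz N) * RatFunc.X) -
        (F.y (F.ρ i) - algebraMap (STz N) F.CR (RatFunc.C (F.u τ i))) =
        algebraMap (STz N) F.CR (RatFunc.C (F.u τ i) + (a : STz N) * RatFunc.X) := by
      rw [map_add]
      change F.y (F.ρ i) + _ - _ = _
      ring
    rw [h3] at h2
    refine hP.ne_top (Ideal.eq_top_of_isUnit_mem _ h2 (IsUnit.map _ ?_))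
    rw [isUnit_iff_ne_zero]
    exact C_add_mul_X_ne_zero _ ha
  | inr l =>
    change IsUnit ((0 : F.CR) + _)
    rw [zero_add]
    apply IsUnit.map
    rw [isUnit_iff_ne_zero]
    simpa using C_add_mul_X_ne_zero (N := N) 0 ha

/-! ### Restriction to a fixed point -/

/-- After the restriction to the component of `σ` and `b`, multiplication by `x` becomes
multiplication by `r`. -/
def ActsBy (hσ : F.IsTop σ) (b : N) (x : F.CR) (r : STz N) : Prop :=
  ∀ f, F.restrict hσ b (x * f) = r * F.restrict hσ b f

namespace ActsBy

variable {hσ : F.IsTop σ} {b : N} {x x' : F.CR} {r r' : STz N}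

theorem scalar (hσ : F.IsTop σ) (b : N) (r : STz N) :
    ActsBy hσ b (algebraMap (STz N) F.CR r) r := fun f => by
  rw [← Algebra.smul_def, map_smul, smul_eq_mul]

theorem one (hσ : F.IsTop σ) (b : N) : ActsBy hσ b 1 1 := fun f => by rw [one_mul, one_mul]

theorem mul (h : ActsBy hσ b x r) (h' : ActsBy hσ b x' r') : ActsBy hσ b (x * x') (r * r') :=
  fun f => by rw [mul_assoc, h, h', mul_assoc]

theorem add (h : ActsBy hσ b x r) (h' : ActsBy hσ b x' r') : ActsBy hσ b (x + x') (r + r') :=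
  fun f => by rw [add_mul, map_add, h, h', add_mul]

theorem pow (h : ActsBy hσ b x r) (k : ℕ) : ActsBy hσ b (x ^ k) (r ^ k) := by
  induction k with
  | zero => simpa using one hσ b
  | succ k ih => simpa only [pow_succ] using ih.mul h

theorem prod {ι : Type*} (s : Finset ι) {x : ι → F.CR} {r : ι → STz N}
    (h : ∀ i ∈ s, ActsBy hσ b (x i) (r i)) : ActsBy hσ b (∏ i ∈ s, x i) (∏ i ∈ s, r i) := by
  induction s using Finset.induction_on with
  | empty => simpa using one hσ b
  | insert i s hi ih =>
    rw [Finset.prod_insert hi, Finset.prod_insert hi]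
    exact (h i (by simp)).mul (ih fun k hk => h k (by simp [hk]))

theorem ringInverse (h : ActsBy hσ b x r) (hx : IsUnit x) (hr : r ≠ 0) :
    ActsBy hσ b (Ring.inverse x) r⁻¹ := fun f => by
  rw [eq_inv_mul_iff_mul_eq₀ hr, ← h, ← mul_assoc, Ring.mul_inverse_cancel _ hx, one_mul]

theorem y_rho (hσ : F.IsTop σ) (b : N) (i : Fin n) :
    ActsBy hσ b (F.y (F.ρ i)) (RatFunc.C (F.u σ i)) := by
  intro f
  obtain ⟨p, hp⟩ := Ideal.Quotient.mk_surjective (I := F.crIdeal) f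
  have h1 : F.restrict hσ b (F.y (F.ρ i) * f) =
      F.component σ b (F.chart σ (MvPolynomial.X (F.ρ i) * p)) := by
    rw [← hp]
    rfl
  have h2 : F.restrict hσ b f = F.component σ b (F.chart σ p) := by
    rw [← hp]
    rfl
  rw [h1, h2, map_mul]
  have h3 : F.chart σ (MvPolynomial.X (F.ρ i)) =
      if i ∈ σ then AddMonoidAlgebra.single (F.ρ i) 1 else 0 := by
    rw [chart, MvPolynomial.aeval_X]
    have : bar (F.ρ i) ∈ F.cone σ ↔ i ∈ σ := ray_mem_cone_iff hσ.1 i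
    simp only [this]
  rw [h3]
  split_ifs with hi
  · induction F.chart σ p using AddMonoidAlgebra.induction_linear with
    | zero => simp
    | add f g hf hg => rw [mul_add, map_add, map_add, hf, hg, mul_add]
    | single c x =>
      rw [AddMonoidAlgebra.single_mul_single, one_mul, add_comm, hσ.component_shift b c hi]
  · rw [zero_mul, map_zero, hσ.u_eq_zero hi, map_zero, zero_mul]

end ActsBy

/-- The weights of the extended classes `u_i` at the fixed point of `σ`. -/
noncomputable def extU (F : StackyFan N n) (σ : Finset (Fin n)) {m : ℕ} : Fin n ⊕ Fin m → ST N :=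
  Sum.elim (F.u σ) 0

variable {m : ℕ}

theorem ActsBy.uCR (hσ : F.IsTop σ) (b : N) (i : Fin n ⊕ Fin m) :
    ActsBy hσ b (F.uCR i) (RatFunc.C (F.extU σ i)) := by
  cases i with
  | inl i => exact ActsBy.y_rho hσ b i
  | inr l =>
    intro f
    simp [StackyFan.uCR, extU]

/-- Uncancelled denominators have `a > 0`, hence are units before and nonzero after restriction. -/
theorem ActsBy.hyperFactor (hσ : F.IsTop σ) (b : N) (i : Fin n ⊕ Fin m) (x : ℚ) :
    ActsBy hσ b (hyperFactor (F.uCR i) (RatFunc.X : STz N) x)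
      (ToricStack.hyperFactor (RatFunc.C (F.extU σ i)) (RatFunc.X : STz N) x) := by
  have hadd : ∀ a : ℚ, ActsBy hσ b
      (F.uCR i + algebraMap (STz N) F.CR ((a : STz N) * RatFunc.X))
      (RatFunc.C (F.extU σ i) + algebraMap (STz N) (STz N) ((a : STz N) * RatFunc.X)) :=
    fun a => (ActsBy.uCR hσ b i).add (ActsBy.scalar hσ b _)
  have f1 := finite_fractIic_diff (Int.fract x) 0 x
  have f2 := finite_fractIic_diff (Int.fract x) x 0
  have hne : ∀ a ∈ fractIic (Int.fract x) x \ fractIic (Int.fract x) 0, a ≠ 0 := by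
    rintro a ⟨h1, h2⟩ rfl
    exact h2 ⟨h1.1, le_rfl⟩
  change ActsBy hσ b (prodQuot (fractIic (Int.fract x) 0) (fractIic (Int.fract x) x) _)
    (prodQuot (fractIic (Int.fract x) 0) (fractIic (Int.fract x) x) _)
  rw [prodQuot, prodQuot, finprod_mem_eq_finite_toFinset_prod _ f1,
    finprod_mem_eq_finite_toFinset_prod _ f2, finprod_mem_eq_finite_toFinset_prod _ f1,
    finprod_mem_eq_finite_toFinset_prod _ f2, Ring.inverse_eq_inv']
  refine (ActsBy.prod _ fun a _ => hadd a).mul ((ActsBy.prod _ fun a _ => hadd a).ringInverse ?_ ?_)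
  · refine Finset.prod_induction _ IsUnit (fun _ _ => IsUnit.mul) isUnit_one fun a ha => ?_
    exact isUnit_uCR_add i (hne a (f2.mem_toFinset.1 ha))
  · exact Finset.prod_ne_zero_iff.2 fun a ha =>
      C_add_mul_X_ne_zero _ (hne a (f2.mem_toFinset.1 ha))

/-- Distinct elements of `Box(σ)` are inequivalent modulo `N_σ`, and the coordinates of `b` have
floor zero, so the monomial of weights is `1`. -/
theorem restrict_y_of_mem_box (hσ : F.IsTop σ) {b b' : N} (hb : b ∈ F.boxOf σ) (hb' : b' ∈ F.box) :
    F.restrict hσ b (F.y b') = if b' = b then 1 else 0 := by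
  obtain ⟨p, z, e⟩ := coord_of_mem_boxOf hσ.1 hb
  have hcone : bar b ∈ F.cone σ := ⟨F.coord b, fun i => (p i).1, z, e⟩
  rw [restrict_y]
  by_cases h : b' = b
  · subst h
    rw [if_pos rfl, if_pos ⟨hcone, by rw [sub_self]; exact AddSubgroup.zero_mem _⟩]
    refine Finset.prod_eq_one fun i _ => ?_
    rw [e, hσ.weight_sum i z, Int.floor_eq_zero_iff.2 ⟨(p i).1, (p i).2⟩, zpow_zero]
  · rw [if_neg h, if_neg]
    rintro ⟨h1, h2⟩
    exact h (eq_of_mem_boxOf hσ.1 (mem_boxOf_of_mem_box hσ.1 hb' h1) hb h2)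

/-! ### The coefficients of the restricted I-function -/

variable {s : Fin m → N}

theorem sum_extDegree (hs : ∀ k, s k ∈ F.suppSet) (d : Fin n → ℚ) (k : Fin m → ℚ) :
    ∑ i, F.extDegree s d k (Sum.inl i) • F.ray i + ∑ l, F.extDegree s d k (Sum.inr l) • bar (s l) =
      ∑ i, d i • F.ray i := by
  simp only [extDegree, Sum.elim_inl, Sum.elim_inr, sub_smul, Finset.sum_sub_distrib,
    Finset.sum_smul]
  rw [Finset.sum_comm, ← sub_eq_zero]
  have : ∀ l, k l • bar (s l) = ∑ i, (k l * F.coord (s l) i) • F.ray i := by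
    intro l
    rw [(coord_spec (hs l)).2, Finset.smul_sum]
    simp only [mul_smul]
  simp only [this]
  abel

/-- Subtracting the relation given by `v` from its rounding up leaves the rounding errors, which
vanish outside a cone. -/
theorem coord_reduction {v : Fin n ⊕ Fin m → ℚ} (hv : v ∈ F.extLattice s) (i : Fin n) :
    F.coord (F.reduction s v) i = ⌈v (Sum.inl i)⌉ - v (Sum.inl i) := by
  obtain ⟨τ, hτ, hrel, hint, hout⟩ := hv
  refine congrFun (coord_eq (a := fun i => ⌈v (Sum.inl i)⌉ - v (Sum.inl i)) hτ
    (fun i => sub_nonneg.2 (Int.le_ceil _)) ?_ ?_) i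
  · intro i hi
    obtain ⟨a, ha⟩ := hout i hi
    simp [ha]
  · rw [← sub_zero (bar _), ← hrel, reduction, bar_add, bar_sum, bar_sum]
    have : ∀ l, (⌈v (Sum.inr l)⌉ : ℚ) = v (Sum.inr l) := by
      intro l
      obtain ⟨a, ha⟩ := hint l
      simp [ha]
    simp only [bar_zsmul, this, sub_smul, Finset.sum_sub_distrib]
    rw [add_sub_add_right_eq_sub]
    rfl

/-- The degrees `(d, k)` that contribute to the restriction of the I-function to the component of
`σ` and `b`. -/
def Contributes (F : StackyFan N n) (s : Fin m → N) (σ : Finset (Fin n)) (b : N) (d : Fin n → ℚ)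
    (k : Fin m →₀ ℕ) : Prop :=
  ∑ i, d i • F.ray i = 0 ∧
    (∀ i, i ∉ σ → ∃ a : ℕ, F.extDegree s d (fun l => (k l : ℚ)) (Sum.inl i) = a) ∧
      F.reduction s (F.extDegree s d (fun l => (k l : ℚ))) = b

theorem Contributes.mem_extLattice (hs : ∀ k, s k ∈ F.suppSet) (hσ : σ ∈ F.cones) {b : N}
    {d : Fin n → ℚ} {k : Fin m →₀ ℕ} (h : F.Contributes s σ b d k) :
    F.extDegree s d (fun l => (k l : ℚ)) ∈ F.extLattice s := by
  refine ⟨σ, hσ, (sum_extDegree hs d _).trans h.1, fun l => ⟨k l, by simp [extDegree]⟩, ?_⟩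
  intro i hi
  obtain ⟨a, ha⟩ := h.2.1 i hi
  exact ⟨a, by simpa using ha⟩

/-- For `i ∉ σ`, `d_i` is `λ_i ≥ 0` plus a nonnegative combination of the coordinates of the `s_l`,
so `d` lies in the dual cone of `σ`. -/
theorem Contributes.mem_extEffective (hs : ∀ k, s k ∈ F.suppSet) (hσ : σ ∈ F.cones) {b : N}
    {d : Fin n → ℚ} {k : Fin m →₀ ℕ} (h : F.Contributes s σ b d k) :
    F.extDegree s d (fun l => (k l : ℚ)) ∈ F.extEffective s b := by
  refine ⟨h.mem_extLattice hs hσ, h.2.2, d, ?_, _, fun l => Nat.cast_nonneg _, rfl⟩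
  have hle : F.dualCone σ ≤ F.moriCone := le_iSup₂_of_le (f := fun σ _ => F.dualCone σ) σ hσ le_rfl
  refine hle ⟨h.1, fun i hi => ?_⟩
  obtain ⟨a, ha⟩ := h.2.1 i hi
  simp only [extDegree, Sum.elim_inl] at ha
  have h1 : 0 ≤ ∑ l, (k l : ℚ) * F.coord (s l) i :=
    Finset.sum_nonneg fun l _ => mul_nonneg (Nat.cast_nonneg _) ((coord_spec (hs l)).1 i)
  have h2 : (0 : ℚ) ≤ a := Nat.cast_nonneg _
  linarith

/-- Since `b_i = 0` outside `σ`, all `λ_i` there are integers, and only a negative one can prevent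
the contribution. Its hypergeometric factor vanishes at `σ`. -/
theorem contributes_of_mem_extEffective (hs : ∀ k, s k ∈ F.suppSet) (hσ : σ ∈ F.cones) {b : N}
    (hb : b ∈ F.boxOf σ) {d : Fin n → ℚ} {k : Fin m →₀ ℕ}
    (h : F.extDegree s d (fun l => (k l : ℚ)) ∈ F.extEffective s b)
    (hn : ¬ F.Contributes s σ b d k) : ∃ i, i ∉ σ ∧
      F.extDegree s d (fun l => (k l : ℚ)) (Sum.inl i) < 0 ∧
      Int.fract (F.extDegree s d (fun l => (k l : ℚ)) (Sum.inl i)) = 0 := by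
  obtain ⟨hlat, hred, -⟩ := h
  have hint : ∀ i, i ∉ σ → F.extDegree s d (fun l => (k l : ℚ)) (Sum.inl i) =
      (⌈F.extDegree s d (fun l => (k l : ℚ)) (Sum.inl i)⌉ : ℤ) := by
    intro i hi
    have h1 := coord_reduction hlat i
    rw [hred, (coord_of_mem_boxOf hσ hb).2.1 i hi] at h1
    linarith
  by_contra hc
  push Not at hc
  refine hn ⟨?_, ?_, hred⟩
  · obtain ⟨τ, -, hrel, -⟩ := hlat
    exact (sum_extDegree hs d _).symm.trans hrel
  · intro i hi
    have h1 : Int.fract (F.extDegree s d (fun l => (k l : ℚ)) (Sum.inl i)) = 0 := by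
      rw [hint i hi, Int.fract_intCast]
    have h2 : 0 ≤ F.extDegree s d (fun l => (k l : ℚ)) (Sum.inl i) := by
      by_contra h3
      exact hc i hi (not_le.1 h3) h1
    rw [hint i hi] at h2
    refine ⟨⌈F.extDegree s d (fun l => (k l : ℚ)) (Sum.inl i)⌉.toNat, (hint i hi).trans ?_⟩
    have h4 := Int.toNat_of_nonneg (Int.cast_nonneg_iff.1 h2)
    exact_mod_cast h4.symm

/-- The coefficients of the restriction of the I-function. -/
theorem extIAt_apply (hs : ∀ k, s k ∈ F.suppSet) (hσ : F.IsTop σ) {b : N} (hb : b ∈ F.boxOf σ)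
    (d : Fin n → ℚ) (k : Fin m →₀ ℕ) (e : Fin n →₀ ℕ) : F.extIAt s hσ b d k e =
      if F.Contributes s σ b d k then
        RatFunc.X * MvPowerSeries.coeff e (expT (STz N)
            (fun i => RatFunc.C (F.u σ i) * RatFunc.X⁻¹ + (d i : STz N))) *
          ∏ i, hyperFactor (RatFunc.C (F.extU σ i)) (RatFunc.X : STz N)
            (F.extDegree s d (fun l => (k l : ℚ)) i)
      else 0 := by
  set v := F.extDegree s d (fun l => (k l : ℚ)) with hv
  have hres : F.extIAt s hσ b d k e = F.restrict hσ b (MvPowerSeries.coeff e (F.extI s d k)) := rfl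
  rw [hres]
  by_cases hS : ∃ b', b' ∈ F.box ∧ v ∈ F.extEffective s b'
  · obtain ⟨b', hb', hv'⟩ := hS
    -- The reduction of `v` determines the box element, so the sum over the box has at most one
    -- term.
    have hset : {b | b ∈ F.box ∧ v ∈ F.extEffective s b} = {b'} := by
      ext x
      constructor
      · rintro ⟨-, hx⟩
        exact hx.2.1.symm.trans hv'.2.1
      · rintro rfl
        exact ⟨hb', hv'⟩
    have hI : F.extI s d k = MvPowerSeries.C (algebraMap (STz N) F.CR RatFunc.X) *
        expT (STz N) (fun i => F.y (F.ρ i) * algebraMap (STz N) F.CR (RatFunc.X)⁻¹ +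
          algebraMap (STz N) F.CR (d i : STz N)) *
        MvPowerSeries.C ((∏ i, hyperFactor (F.uCR i) (RatFunc.X : STz N) (v i)) * F.y b') := by
      rw [← expT_add, extI]
      rw [← hv, hset, finsum_mem_singleton]
      ring
    rw [hI, MvPowerSeries.coeff_mul_C, MvPowerSeries.coeff_C_mul, ← mul_assoc]
    have hact := (((ActsBy.scalar hσ b RatFunc.X).mul (ActsBy.prod Finset.univ fun i _ =>
      (ActsBy.scalar hσ b ((Nat.factorial (e i) : STz N)⁻¹)).mul
        ((((ActsBy.y_rho hσ b i).mul (ActsBy.scalar hσ b (RatFunc.X)⁻¹)).add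
          (ActsBy.scalar hσ b (d i : STz N))).pow (e i)))).mul
        (ActsBy.prod Finset.univ fun i _ => ActsBy.hyperFactor hσ b i (v i))) (F.y b')
    refine hact.trans ?_
    rw [restrict_y_of_mem_box hσ hb hb']
    by_cases hbb : b' = b
    · subst hbb
      rw [if_pos rfl, mul_one]
      split_ifs with hC
      · rfl
      · obtain ⟨i, hi, hneg, hfr⟩ := contributes_of_mem_extEffective hs hσ.1 hb hv' hC
        rw [Finset.prod_eq_zero (Finset.mem_univ (Sum.inl i)), mul_zero]
        have := hyperFactor_eq_zero (K := STz N) (z := RatFunc.X) (le_refl (0 : ℚ)) hneg hfr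
        simpa [extU, hσ.u_eq_zero hi] using this
    · rw [if_neg hbb, mul_zero, if_neg]
      exact fun hC => hbb (hv'.2.1.symm.trans hC.2.2)
  · have hset : {b | b ∈ F.box ∧ v ∈ F.extEffective s b} = ∅ :=
      Set.eq_empty_iff_forall_notMem.2 fun x hx => hS ⟨x, hx⟩
    have hI : F.extI s d k = 0 := by
      rw [extI]
      rw [← hv, hset, finsum_mem_empty, mul_zero]
    rw [hI, map_zero, map_zero, if_neg]
    exact fun hC => hS ⟨b, boxOf_subset_box hσ.1 hb, hC.mem_extEffective hs hσ.1⟩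

end StackyFan

/-! ### Values and residues of the restricted I-function -/

section Values

variable {K : Type*} [Field K]

theorem HasValueAt.linear (z u : K) (a : ℚ) : HasValueAt z
    (RatFunc.C u + algebraMap (RatFunc K) (RatFunc K) ((a : RatFunc K) * RatFunc.X))
    (u + (a : K) * z) := by
  have := (HasValueAt.C z (a : K)).mul (HasValueAt.X z)
  rw [map_ratCast] at this
  exact (HasValueAt.C z u).add this

theorem HasValueAt.hyperFactor {z u : K} {x : ℚ}
    (h : ∀ a : ℚ, Int.fract a = Int.fract x → 0 < a → a ≤ x → u + (a : K) * z ≠ 0) :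
    HasValueAt z (hyperFactor (RatFunc.C u) (RatFunc.X : RatFunc K) x)
      (ToricStack.hyperFactor u z x) := by
  change HasValueAt z (prodQuot (fractIic (Int.fract x) 0) (fractIic (Int.fract x) x) _)
    (prodQuot (fractIic (Int.fract x) 0) (fractIic (Int.fract x) x) _)
  rw [prodQuot, prodQuot, Ring.inverse_eq_inv', Ring.inverse_eq_inv']
  refine (HasValueAt.finprod (finite_fractIic_diff _ _ _) fun a _ => HasValueAt.linear z u a).mul
    ((HasValueAt.finprod (finite_fractIic_diff _ _ _) fun a _ => HasValueAt.linear z u a).inv ?_)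
  refine finprod_mem_ne_zero fun a ha => h a ha.1.1 ?_ ha.1.2
  exact not_le.1 fun h0 => ha.2 ⟨ha.1.1, h0⟩

/-- As `x > 0`, only a denominator survives. Its factor at `a = c` equals `c (X - z)`, and the
others are nonzero at `z`. -/
theorem exists_hyperFactor_eq_mul_inv [CharZero K] {z u : K} {x c : ℚ} (hc : 0 < c) (hcx : c ≤ x)
    (hf : Int.fract x = Int.fract c) (hz : z = -u / (c : K))
    (h : ∀ a : ℚ, 0 < a → a ≠ c → u + (a : K) * z ≠ 0) :
    ∃ g, HasValueAt z g (1 / (c : K) *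
        (∏ᶠ a ∈ (fractIic (Int.fract x) x \ fractIic (Int.fract x) 0) \ {c},
          (u + (a : K) * z))⁻¹) ∧
      hyperFactor (RatFunc.C u) (RatFunc.X : RatFunc K) x = g * (RatFunc.X - RatFunc.C z)⁻¹ := by
  have hcK : (c : K) ≠ 0 := by exact_mod_cast hc.ne'
  set S := fractIic (Int.fract x) x \ fractIic (Int.fract x) 0 with hS
  have hSf : S.Finite := finite_fractIic_diff _ _ _
  have hSf' : (S \ {c}).Finite := hSf.subset Set.sdiff_subset
  have hcS : c ∈ S := ⟨⟨hf.symm, hcx⟩, fun h0 => absurd h0.2 (not_le.2 hc)⟩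
  refine ⟨(RatFunc.C (c : K))⁻¹ * (∏ᶠ a ∈ S \ {c}, (RatFunc.C u +
    algebraMap (RatFunc K) (RatFunc K) ((a : RatFunc K) * RatFunc.X)))⁻¹, ?_, ?_⟩
  · rw [one_div]
    refine ((HasValueAt.C z (c : K)).inv hcK).mul
      ((HasValueAt.finprod hSf' fun a _ => HasValueAt.linear z u a).inv ?_)
    refine finprod_mem_ne_zero fun a ha => h a ?_ ha.2
    exact not_le.1 fun h0 => ha.1.2 ⟨ha.1.1.1, h0⟩
  · change prodQuot (fractIic (Int.fract x) 0) (fractIic (Int.fract x) x) _ = _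
    rw [prodQuot_fractIic le_rfl (hc.le.trans hcx) (fun a _ h1 h2 _ => absurd h1 (not_lt.2 h2)),
      Set.sdiff_self, finprod_mem_empty, ← hS]
    have hins : S = insert c (S \ {c}) := by
      rw [Set.insert_sdiff_singleton, Set.insert_eq_of_mem hcS]
    conv_lhs => rw [hins]
    rw [finprod_mem_insert _ (by simp) hSf']
    have hfac : RatFunc.C u + algebraMap (RatFunc K) (RatFunc K) ((c : RatFunc K) * RatFunc.X) =
        RatFunc.C (c : K) * (RatFunc.X - RatFunc.C z) := by
      have hu : u = -((c : K) * z) := by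
        rw [hz]
        field_simp
      rw [Algebra.algebraMap_self, RingHom.id_apply, hu, map_neg, map_mul, map_ratCast]
      ring
    rw [hfac, one_div, mul_inv, mul_inv]
    ring

theorem HasValueAt.coeff_expT [CharZero K] {z : K} {n : ℕ} {f : Fin n → RatFunc K} {v : Fin n → K}
    (h : ∀ i, HasValueAt z (f i) (v i)) (e : Fin n →₀ ℕ) :
    HasValueAt z (MvPowerSeries.coeff e (expT (RatFunc K) f))
      (MvPowerSeries.coeff e (expT K v)) := by
  change HasValueAt z
    (∏ i, algebraMap (RatFunc K) (RatFunc K) ((Nat.factorial (e i) : RatFunc K)⁻¹) * f i ^ e i)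
    (∏ i, algebraMap K K ((Nat.factorial (e i) : K)⁻¹) * v i ^ e i)
  refine HasValueAt.prod _ fun i _ => HasValueAt.mul ?_ ((h i).pow _)
  have := (HasValueAt.C z (Nat.factorial (e i) : K)).inv
    (by exact_mod_cast Nat.factorial_ne_zero (e i))
  rwa [map_natCast] at this

end Values

namespace StackyFan

variable {N : Type*} [AddCommGroup N] {n m : ℕ} {F : StackyFan N n} {σ σ' : Finset (Fin n)}
  {s : Fin m → N}

theorem hasValueAt_exponent (σ : Finset (Fin n)) (d : Fin n → ℚ) {z : ST N} (hz : z ≠ 0)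
    (i : Fin n) : HasValueAt z (RatFunc.C (F.u σ i) * RatFunc.X⁻¹ + (d i : STz N))
      (F.u σ i * z⁻¹ + (d i : ST N)) := by
  have := ((HasValueAt.C z (F.u σ i)).mul ((HasValueAt.X z).inv hz)).add
    (HasValueAt.C z (d i : ST N))
  rwa [map_ratCast] at this

theorem hasValueAt_extIAt (hs : ∀ k, s k ∈ F.suppSet) (hσ : F.IsTop σ) {b : N} (hb : b ∈ F.boxOf σ)
    (d : Fin n → ℚ) (k : Fin m →₀ ℕ) (e : Fin n →₀ ℕ) {z : ST N} (hz : z ≠ 0)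
    (h : ∀ i (a : ℚ), 0 < a → a ≤ F.extDegree s d (fun l => (k l : ℚ)) i →
      F.extU σ i + (a : ST N) * z ≠ 0) :
    HasValueAt z (F.extIAt s hσ b d k e) (if F.Contributes s σ b d k then
      z * MvPowerSeries.coeff e (expT (ST N) (fun i => F.u σ i * z⁻¹ + (d i : ST N))) *
        ∏ i, hyperFactor (F.extU σ i) z (F.extDegree s d (fun l => (k l : ℚ)) i) else 0) := by
  rw [extIAt_apply hs hσ hb]
  split_ifs with hC
  · exact ((HasValueAt.X z).mul (HasValueAt.coeff_expT (hasValueAt_exponent σ d hz) e)).mul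
      (HasValueAt.prod _ fun i _ => HasValueAt.hyperFactor fun a _ => h i a)
  · simpa using HasValueAt.C z 0

/-! ### Fractional parts of contributing degrees. -/

theorem ceil_sub_self_eq_fract_neg (x : ℚ) : (⌈x⌉ : ℚ) - x = Int.fract (-x) := by
  rw [← Int.self_sub_floor, Int.floor_neg]
  push_cast
  ring

theorem coord_hat_eq_zero_iff (hσ : σ ∈ F.cones) {b : N} (hb : b ∈ F.boxOf σ) (i : Fin n) :
    F.coord (F.hat b) i = 0 ↔ F.coord b i = 0 := by
  obtain ⟨p, -, -⟩ := coord_of_mem_boxOf hσ hb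
  rw [coord_hat hσ hb, sub_eq_zero]
  constructor
  · intro h
    have h1 : ⌈F.coord b i⌉ = 0 := by
      have h2 : (⌈F.coord b i⌉ : ℚ) < 1 := h.trans_lt (p i).2
      have h3 : (0 : ℚ) ≤ ⌈F.coord b i⌉ := (p i).1.trans_eq h.symm
      have h4 : ⌈F.coord b i⌉ < 1 := by exact_mod_cast h2
      have h5 : 0 ≤ ⌈F.coord b i⌉ := by exact_mod_cast h3
      omega
    rw [← h, h1, Int.cast_zero]
  · intro h
    simp [h]

theorem Contributes.coord_eq (hs : ∀ k, s k ∈ F.suppSet) (hσ : σ ∈ F.cones) {b : N}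
    {d : Fin n → ℚ} {k : Fin m →₀ ℕ} (h : F.Contributes s σ b d k) (i : Fin n) :
    F.coord b i = ⌈F.extDegree s d (fun l => (k l : ℚ)) (Sum.inl i)⌉ -
      F.extDegree s d (fun l => (k l : ℚ)) (Sum.inl i) := by
  rw [← coord_reduction (h.mem_extLattice hs hσ), h.2.2]

/-- This identifies the residue classes in the I-function with those in `RC(c)`. At `i = j` it puts
`a = c` in the right class. -/
theorem Contributes.fract_eq (hs : ∀ k, s k ∈ F.suppSet) (hσ : σ ∈ F.cones) {b : N}
    (hb : b ∈ F.boxOf σ) {d : Fin n → ℚ} {k : Fin m →₀ ℕ} (h : F.Contributes s σ b d k)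
    (i : Fin n) : Int.fract (F.extDegree s d (fun l => (k l : ℚ)) (Sum.inl i)) =
      F.coord (F.hat b) i := by
  rw [coord_hat hσ hb, ceil_sub_self_eq_fract_neg, h.coord_eq hs hσ, neg_sub, Int.fract_sub_intCast]

theorem extDegree_sub_inl (d l : Fin n → ℚ) (k : Fin m → ℚ) (i : Fin n) :
    F.extDegree s (d - l) k (Sum.inl i) = F.extDegree s d k (Sum.inl i) - l i := by
  simp only [extDegree, Sum.elim_inl, Pi.sub_apply]
  ring

theorem extDegree_sub_inr (d l : Fin n → ℚ) (k : Fin m → ℚ) (i : Fin m) :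
    F.extDegree s (d - l) k (Sum.inr i) = F.extDegree s d k (Sum.inr i) := rfl

theorem reduction_extDegree_sub (d l : Fin n → ℚ) (k : Fin m → ℚ) :
    F.reduction s (F.extDegree s (d - l) k) = F.reduction s (F.extDegree s d k) -
      ∑ i, (⌈F.extDegree s d k (Sum.inl i)⌉ - ⌈F.extDegree s d k (Sum.inl i) - l i⌉) • F.ρ i := by
  simp only [reduction, extDegree_sub_inl, extDegree_sub_inr, sub_smul, Finset.sum_sub_distrib]
  abel

/-! ### Matching of degrees and factors at the two fixed points. -/

namespace Adjacent

variable {j j' : Fin n} (h : F.Adjacent σ σ' j j')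
include h

theorem sum_sub_curveDegree (d : Fin n → ℚ) (c : ℚ) :
    ∑ i, (d - F.curveDegree σ σ' j c) i • F.ray i = ∑ i, d i • F.ray i := by
  simp only [Pi.sub_apply, sub_smul, Finset.sum_sub_distrib, (h.curveDegree_spec c).2.2, sub_zero]

/-- The only new condition concerns `j`: both `b_j + λ_j` and `b_j + c` are integers, so `λ_j - c`
is one, and it is nonnegative by `hcj`. -/
theorem contributes_right (hs : ∀ k, s k ∈ F.suppSet) {b : N} (hb : b ∈ F.boxOf σ) {c : ℚ}
    (hcb : Int.fract c = F.coord (F.hat b) j) {d : Fin n → ℚ} {k : Fin m →₀ ℕ}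
    (hC : F.Contributes s σ b d k) (hcj : c ≤ F.extDegree s d (fun l => (k l : ℚ)) (Sum.inl j)) :
    F.Contributes s σ' (b - ∑ i, ⌊F.coord b i + F.curveDegree σ σ' j c i⌋ • F.ρ i)
      (d - F.curveDegree σ σ' j c) k := by
  obtain ⟨hj, hz, -⟩ := h.curveDegree_spec c
  have hco := hC.coord_eq hs h.left.1
  refine ⟨(h.sum_sub_curveDegree d c).trans hC.1, ?_, ?_⟩
  · intro i hi
    rw [extDegree_sub_inl]
    by_cases hij : i = j
    · subst hij
      rw [hj]
      have h1 := h.isInt_coord_add hb hcb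
      rw [hco i] at h1
      set x := F.extDegree s d (fun l => (k l : ℚ)) (Sum.inl i)
      have h2 : x - c = (⌈x⌉ - (⌈(⌈x⌉ : ℚ) - x⌉ + ⌊c⌋) : ℤ) := by
        rw [Int.cast_sub, ← h1]
        ring
      have h3 : 0 ≤ ⌈x⌉ - (⌈(⌈x⌉ : ℚ) - x⌉ + ⌊c⌋) := by
        have h4 : 0 ≤ x - c := sub_nonneg.2 hcj
        rw [h2] at h4
        exact_mod_cast h4
      obtain ⟨a, ha⟩ := Int.eq_ofNat_of_zero_le h3
      exact ⟨a, by rw [h2, ha, Int.cast_natCast]⟩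
    · have hi' : i ∉ σ := fun hm => hi (h.mem_right_of_mem_left hm hij)
      rw [hz i (by simp [hi, hi']), sub_zero]
      exact hC.2.1 i hi'
  · rw [reduction_extDegree_sub, hC.2.2]
    congr 1
    refine Finset.sum_congr rfl fun i _ => ?_
    congr 1
    rw [hco i]
    set x := F.extDegree s d (fun l => (k l : ℚ)) (Sum.inl i)
    -- Thus `⌊b_i + l_i⌋ = ⌈λ_i⌉ - ⌈λ_i - l_i⌉`, which is exactly the change of the reduction under
    -- `λ ↦ λ - l`.
    rw [show (⌈x⌉ : ℚ) - x + F.curveDegree σ σ' j c i =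
      -(x - F.curveDegree σ σ' j c i) + (⌈x⌉ : ℤ) by ring, Int.floor_add_intCast, Int.floor_neg]
    ring

/-- This recovers `λ_i ≡ -b_i` modulo `ℤ` from data at `σ'` alone, also for degrees that do not
contribute at `σ`. -/
theorem coord_eq_of_contributes_right (hs : ∀ k, s k ∈ F.suppSet) {b : N} (hb : b ∈ F.boxOf σ)
    {c : ℚ} (hcb : Int.fract c = F.coord (F.hat b) j) {d : Fin n → ℚ} {k : Fin m →₀ ℕ}
    (hC : F.Contributes s σ' (b - ∑ i, ⌊F.coord b i + F.curveDegree σ σ' j c i⌋ • F.ρ i)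
      (d - F.curveDegree σ σ' j c) k) (i : Fin n) :
    F.extDegree s d (fun l => (k l : ℚ)) (Sum.inl i) = -F.coord b i +
      (⌈F.extDegree s d (fun l => (k l : ℚ)) (Sum.inl i) - F.curveDegree σ σ' j c i⌉ +
        ⌊F.coord b i + F.curveDegree σ σ' j c i⌋ : ℤ) := by
  have h1 := hC.coord_eq hs h.right.1 i
  rw [h.coord_oppositeBox hb hcb, extDegree_sub_inl, ← Int.self_sub_floor] at h1
  push_cast
  linarith

/-- Here the sign at `j'` must be assumed, while `c ≤ λ_j` comes for free from `j ∉ σ'`. The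
reductions match because `-1 < -b_i ≤ 0` determines `⌈λ_i⌉`. -/
theorem contributes_left (hs : ∀ k, s k ∈ F.suppSet) {b : N} (hb : b ∈ F.boxOf σ) {c : ℚ}
    (hcb : Int.fract c = F.coord (F.hat b) j) {d : Fin n → ℚ} {k : Fin m →₀ ℕ}
    (hC : F.Contributes s σ' (b - ∑ i, ⌊F.coord b i + F.curveDegree σ σ' j c i⌋ • F.ρ i)
      (d - F.curveDegree σ σ' j c) k)
    (hcj : 0 ≤ F.extDegree s d (fun l => (k l : ℚ)) (Sum.inl j')) :
    F.Contributes s σ b d k ∧ c ≤ F.extDegree s d (fun l => (k l : ℚ)) (Sum.inl j) := by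
  obtain ⟨hj, hz, -⟩ := h.curveDegree_spec c
  obtain ⟨p, z, -⟩ := coord_of_mem_boxOf h.left.1 hb
  have hco := h.coord_eq_of_contributes_right hs hb hcb hC
  refine ⟨⟨(h.sum_sub_curveDegree d c).symm.trans hC.1, ?_, ?_⟩, ?_⟩
  · intro i hi
    by_cases hij : i = j'
    · subst hij
      have h1 := hco i
      rw [z i hi, neg_zero, zero_add] at h1
      rw [h1] at hcj
      obtain ⟨a, ha⟩ := Int.eq_ofNat_of_zero_le (Int.cast_nonneg_iff.1 hcj)
      exact ⟨a, by rw [h1, ha, Int.cast_natCast]⟩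
    · have hi' : i ∉ σ' := fun hm => hi (h.mem_left_of_mem_right hm hij)
      have h1 := hC.2.1 i hi'
      rwa [extDegree_sub_inl, hz i (by simp [hi, hi']), sub_zero] at h1
  · have h1 := hC.2.2
    rw [reduction_extDegree_sub, sub_eq_iff_eq_add, sub_add_eq_add_sub, add_sub_assoc,
      ← Finset.sum_sub_distrib] at h1
    rw [h1, add_eq_left]
    refine Finset.sum_eq_zero fun i _ => ?_
    rw [← sub_smul]
    have h2 : ⌈F.extDegree s d (fun l => (k l : ℚ)) (Sum.inl i)⌉ =
        ⌈F.extDegree s d (fun l => (k l : ℚ)) (Sum.inl i) - F.curveDegree σ σ' j c i⌉ +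
          ⌊F.coord b i + F.curveDegree σ σ' j c i⌋ := by
      conv_lhs => rw [hco i]
      have h3 : ⌈-F.coord b i⌉ = 0 := by
        rw [Int.ceil_eq_zero_iff]
        constructor <;> linarith [(p i).1, (p i).2]
      rw [Int.ceil_add_intCast, h3, zero_add]
    rw [h2]
    convert zero_smul ℤ (F.ρ i) using 2
    ring
  · obtain ⟨a, ha⟩ := hC.2.1 j h.mem_left.2
    rw [extDegree_sub_inl, hj] at ha
    have : (0 : ℚ) ≤ a := Nat.cast_nonneg a
    linarith

/-- The contribution of the class `u_i` to the recursion coefficient. -/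
noncomputable def recursionFactor (_ : F.Adjacent σ σ' j j') (b : N) (c : ℚ) (i : Fin n) : ST N :=
  if i = j then (if Int.fract c = 0 then F.u σ j else 1) *
    (((c : ST N) / F.u σ j) ^ ⌊c⌋₊ / (Nat.factorial ⌊c⌋₊ : ST N))
  else if i = j' then (-((c : ST N) / F.u σ j)) ^ ⌊F.curveDegree σ σ' j c j'⌋₊ /
    (Nat.factorial ⌊F.curveDegree σ σ' j c j'⌋₊ : ST N)
  else if i ∈ σ ∩ σ' then (if F.coord b i = 0 then F.u σ i else 1) *
    prodQuot {a | Int.fract a = F.coord (F.hat b) i ∧ a < 0}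
      {a | Int.fract a = F.coord (F.hat b) i ∧ a ≤ F.curveDegree σ σ' j c i}
      (fun a => F.u σ i + F.u σ j * ((a : ST N) / (-(c : ST N))))
  else 1

/-- Regrouping by rays: `σ` is the wall together with `j`, and `u_j(σ)` occurs in the product over
`b_i = 0` exactly when `c` is an integer. -/
theorem recursionCoeff_eq {b : N} (hb : b ∈ F.boxOf σ) {c : ℚ}
    (hcb : Int.fract c = F.coord (F.hat b) j) : F.recursionCoeff σ σ' j j' b c =
      1 / (c : ST N) * ∏ i, h.recursionFactor b c i := by
  have hjI : j ∉ σ ∩ σ' := fun hm => h.mem_left.2 (Finset.mem_inter.1 hm).2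
  have hj'I : j' ∉ σ ∩ σ' := fun hm => h.mem_right.2 (Finset.mem_inter.1 hm).1
  have hσ : σ = insert j (σ ∩ σ') := by
    ext i
    rw [Finset.mem_insert, Finset.mem_inter]
    constructor
    · intro hi
      by_cases hij : i = j
      · exact Or.inl hij
      · exact Or.inr ⟨hi, h.mem_right_of_mem_left hi hij⟩
    · rintro (rfl | hi)
      · exact h.mem_left.1
      · exact hi.1
  have h1 : ∏ i, h.recursionFactor b c i =
      ∏ i ∈ insert j (insert j' (σ ∩ σ')), h.recursionFactor b c i := by
    symm
    apply Finset.prod_subset (Finset.subset_univ _)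
    intro i _ hi
    rw [Finset.mem_insert, Finset.mem_insert, not_or, not_or] at hi
    rw [recursionFactor, if_neg hi.1, if_neg hi.2.1, if_neg hi.2.2]
  have h2 : ∏ i ∈ σ ∩ σ', h.recursionFactor b c i =
      (∏ i ∈ σ ∩ σ', if F.coord b i = 0 then F.u σ i else 1) *
      ∏ i ∈ σ ∩ σ', prodQuot {a | Int.fract a = F.coord (F.hat b) i ∧ a < 0}
        {a | Int.fract a = F.coord (F.hat b) i ∧ a ≤ F.curveDegree σ σ' j c i}
        (fun a => F.u σ i + F.u σ j * ((a : ST N) / (-(c : ST N)))) := by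
    rw [← Finset.prod_mul_distrib]
    refine Finset.prod_congr rfl fun i hi => ?_
    rw [recursionFactor, if_neg (fun e : i = j => hjI (e ▸ hi)),
      if_neg (fun e : i = j' => hj'I (e ▸ hi)), if_pos hi]
  have h3 : ∏ i ∈ σ with F.coord b i = 0, F.u σ i = (if Int.fract c = 0 then F.u σ j else 1) *
      ∏ i ∈ σ ∩ σ', if F.coord b i = 0 then F.u σ i else 1 := by
    rw [Finset.prod_filter]
    have h4 : ∏ i ∈ σ, (if F.coord b i = 0 then F.u σ i else 1) =
        ∏ i ∈ insert j (σ ∩ σ'), if F.coord b i = 0 then F.u σ i else 1 := by rw [← hσ]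
    rw [h4, Finset.prod_insert hjI]
    simp only [hcb, coord_hat_eq_zero_iff h.left.1 hb]
  have hji : j ∉ insert j' (σ ∩ σ') := by
    rw [Finset.mem_insert, not_or]
    exact ⟨h.ne, hjI⟩
  rw [recursionCoeff, h1, Finset.prod_insert hji, Finset.prod_insert hj'I, h2, h3]
  rw [recursionFactor, if_pos rfl, recursionFactor, if_neg h.ne.symm, if_pos rfl]
  ring

/-- Three cases: a ray of the wall, the ray `j'` with weight zero at `σ`, and a ray outside both
cones, where weight and `l_i` vanish and nothing changes. -/
theorem hyperFactor_eq_recursionFactor_mul (hs : ∀ k, s k ∈ F.suppSet) {b : N}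
    (hb : b ∈ F.boxOf σ) {c : ℚ} (hc : 0 < c) {d : Fin n → ℚ} {k : Fin m →₀ ℕ}
    (hC : F.Contributes s σ b d k) {i : Fin n} (hij : i ≠ j) :
    hyperFactor (F.u σ i) (-(F.u σ j) / (c : ST N))
        (F.extDegree s d (fun l => (k l : ℚ)) (Sum.inl i)) = h.recursionFactor b c i *
      hyperFactor (F.u σ' i) (-(F.u σ j) / (c : ST N))
        (F.extDegree s (d - F.curveDegree σ σ' j c) (fun l => (k l : ℚ)) (Sum.inl i)) := by
  obtain ⟨hj, hz, -⟩ := h.curveDegree_spec c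
  rw [extDegree_sub_inl, h.u_right hc]
  set x := F.extDegree s d (fun l => (k l : ℚ)) (Sum.inl i) with hx
  rw [recursionFactor, if_neg hij]
  by_cases hi : i ∈ σ
  · have hiI : i ∈ σ ∩ σ' := Finset.mem_inter.2 ⟨hi, h.mem_right_of_mem_left hi hij⟩
    rw [if_neg (fun e : i = j' => h.mem_right.2 (e ▸ hi)), if_pos hiI,
      hyperFactor_eq_mul x (F.curveDegree σ σ' j c i) (h.u_add_ne_zero hi hij)]
    have hfr := hC.fract_eq hs h.left.1 hb i
    rw [← hx] at hfr
    simp only [hfr, coord_hat_eq_zero_iff h.left.1 hb]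
    congr 3
    funext a
    rw [div_neg, neg_div]
    ring
  · obtain ⟨a, ha⟩ := hC.2.1 i hi
    rw [← hx] at ha
    rw [h.left.u_eq_zero hi, zero_add]
    by_cases hij' : i = j'
    · subst hij'
      rw [if_pos rfl, hyperFactor_zero_eq_mul (h.pole_ne_zero hc) (h.curveDegree_pos hc).le
        (by rw [ha]; exact Nat.cast_nonneg _) (by rw [ha, Int.fract_natCast]),
        neg_div, inv_neg, inv_div]
    · have hi' : i ∉ σ' := fun hm => hi (h.mem_left_of_mem_right hm hij')
      rw [if_neg hij', if_neg (fun hm => hi (Finset.mem_inter.1 hm).1), one_mul,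
        hz i (by simp [hi, hi']), Rat.cast_zero, zero_mul, sub_zero]

/-- Division by `z` turns the shift `l_i z` of the weight into `l_i`, which compensates the shift of
`d_i`. -/
theorem u_mul_inv_add {c : ℚ} (hc : 0 < c) (d : Fin n → ℚ) (i : Fin n) :
    F.u σ i * (-(F.u σ j) / (c : ST N))⁻¹ + (d i : ST N) =
      F.u σ' i * (-(F.u σ j) / (c : ST N))⁻¹ +
        ((d - F.curveDegree σ σ' j c) i : ST N) := by
  rw [h.u_right hc, Pi.sub_apply, add_mul, mul_assoc, mul_inv_cancel₀ (h.pole_ne_zero hc)]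
  push_cast
  ring

/-! ### Values at `σ'` and residues at `σ`. -/

theorem hasValueAt_extIAt_right (hs : ∀ k, s k ∈ F.suppSet) {b' : N} (hb' : b' ∈ F.boxOf σ')
    {c : ℚ} (hc : 0 < c) (d : Fin n → ℚ) (k : Fin m →₀ ℕ) (e : Fin n →₀ ℕ) :
    HasValueAt (-(F.u σ j) / (c : ST N)) (F.extIAt s h.right b' d k e)
      (if F.Contributes s σ' b' d k then
        -(F.u σ j) / (c : ST N) * MvPowerSeries.coeff e (expT (ST N)
          (fun i => F.u σ' i * (-(F.u σ j) / (c : ST N))⁻¹ + (d i : ST N))) *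
        ∏ i, hyperFactor (F.extU σ' i) (-(F.u σ j) / (c : ST N))
          (F.extDegree s d (fun l => (k l : ℚ)) i) else 0) := by
  refine hasValueAt_extIAt hs h.right hb' d k e (h.pole_ne_zero hc) ?_
  rintro (i | i) a ha -
  · exact h.u_right_add_ne_zero hc i ha
  · change (0 : ST N) + _ ≠ 0
    rw [zero_add]
    exact mul_ne_zero (by exact_mod_cast ha.ne') (h.pole_ne_zero hc)

theorem residueAt_extIAt_eq_zero (hs : ∀ k, s k ∈ F.suppSet) {b : N} (hb : b ∈ F.boxOf σ)
    {c : ℚ} (hc : 0 < c) {d : Fin n → ℚ} {k : Fin m →₀ ℕ} (e : Fin n →₀ ℕ)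
    (hn : ¬ (F.Contributes s σ b d k ∧
      c ≤ F.extDegree s d (fun l => (k l : ℚ)) (Sum.inl j))) :
    residueAt (-(F.u σ j) / (c : ST N)) (F.extIAt s h.left b d k e) = 0 := by
  by_cases hC : F.Contributes s σ b d k
  · refine (hasValueAt_extIAt hs h.left hb d k e (h.pole_ne_zero hc) ?_).residueAt_eq_zero
    rintro (i | i) a ha hax
    · refine h.u_left_add_ne_zero hc i ha ?_
      rintro rfl rfl
      exact hn ⟨hC, hax⟩
    · change (0 : ST N) + _ ≠ 0
      rw [zero_add]
      exact mul_ne_zero (by exact_mod_cast ha.ne') (h.pole_ne_zero hc)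
  · rw [extIAt_apply hs h.left hb, if_neg hC]
    simpa using (HasValueAt.C (-(F.u σ j) / (c : ST N)) 0).residueAt_eq_zero

theorem residueAt_extIAt (hs : ∀ k, s k ∈ F.suppSet) {b : N} (hb : b ∈ F.boxOf σ)
    {c : ℚ} (hc : 0 < c) (hcb : Int.fract c = F.coord (F.hat b) j) {d : Fin n → ℚ}
    {k : Fin m →₀ ℕ} (e : Fin n →₀ ℕ) (hC : F.Contributes s σ b d k)
    (hcj : c ≤ F.extDegree s d (fun l => (k l : ℚ)) (Sum.inl j)) :
    residueAt (-(F.u σ j) / (c : ST N)) (F.extIAt s h.left b d k e) =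
      F.recursionCoeff σ σ' j j' b c * (-(F.u σ j) / (c : ST N) *
        MvPowerSeries.coeff e (expT (ST N)
          (fun i => F.u σ' i * (-(F.u σ j) / (c : ST N))⁻¹ +
            ((d - F.curveDegree σ σ' j c) i : ST N))) *
        ∏ i, hyperFactor (F.extU σ' i) (-(F.u σ j) / (c : ST N))
          (F.extDegree s (d - F.curveDegree σ σ' j c) (fun l => (k l : ℚ)) i)) := by
  have hfr : Int.fract (F.extDegree s d (fun l => (k l : ℚ)) (Sum.inl j)) = Int.fract c :=
    (hC.fract_eq hs h.left.1 hb j).trans hcb.symm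
  have hne := h.pole_ne_zero hc
  set z := -(F.u σ j) / (c : ST N) with hz
  set v := F.extDegree s d (fun l => (k l : ℚ)) with hv
  set v' := F.extDegree s (d - F.curveDegree σ σ' j c) (fun l => (k l : ℚ)) with hv'
  obtain ⟨g, hg, hgeq⟩ := exists_hyperFactor_eq_mul_inv hc hcj hfr hz
    (fun a ha hac => h.u_left_add_ne_zero hc j ha fun _ => hac)
  rw [residue_factor_eq hc hcj hfr (h.left.u_ne_zero h.mem_left.1) hz] at hg
  have hrest : ∀ i ∈ Finset.univ.erase (Sum.inl j : Fin n ⊕ Fin m),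
      HasValueAt z (hyperFactor (RatFunc.C (F.extU σ i)) (RatFunc.X : STz N) (v i))
        (hyperFactor (F.extU σ i) z (v i)) := by
    rintro (i | i) hi
    · refine HasValueAt.hyperFactor fun a _ ha _ => h.u_left_add_ne_zero hc i ha ?_
      rintro rfl
      exact absurd rfl (Finset.ne_of_mem_erase hi)
    · refine HasValueAt.hyperFactor fun a _ ha _ => ?_
      change (0 : ST N) + _ ≠ 0
      rw [zero_add]
      exact mul_ne_zero (by exact_mod_cast ha.ne') hne
  have hval := (((HasValueAt.X z).mul (HasValueAt.coeff_expT (hasValueAt_exponent (F := F) σ d hne)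
    e)).mul (hg.mul (HasValueAt.prod _ hrest))).residueAt_mul_inv
  have hI : F.extIAt s h.left b d k e = RatFunc.X * MvPowerSeries.coeff e (expT (STz N)
      (fun i => RatFunc.C (F.u σ i) * RatFunc.X⁻¹ + (d i : STz N))) *
        (g * ∏ i ∈ Finset.univ.erase (Sum.inl j : Fin n ⊕ Fin m),
          hyperFactor (RatFunc.C (F.extU σ i)) (RatFunc.X : STz N) (v i)) *
        (RatFunc.X - RatFunc.C z)⁻¹ := by
    rw [extIAt_apply hs h.left hb, if_pos hC, ← Finset.mul_prod_erase _ _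
      (Finset.mem_univ (Sum.inl j : Fin n ⊕ Fin m))]
    have : F.extU σ (Sum.inl j : Fin n ⊕ Fin m) = F.u σ j := rfl
    rw [this, ← hv, hgeq]
    ring
  rw [hI, hval, h.recursionCoeff_eq hb hcb]
  have hexp : (fun i => F.u σ i * z⁻¹ + (d i : ST N)) = fun i => F.u σ' i * z⁻¹ +
      ((d - F.curveDegree σ σ' j c) i : ST N) := funext fun i => h.u_mul_inv_add hc d i
  rw [hexp]
  -- The extended classes have weight zero at both points and the same `k`, so they contribute `1`
  -- to the recursion coefficient.
  have hprod : ∏ i, (Sum.elim (h.recursionFactor b c) (fun _ => 1) i *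
      hyperFactor (F.extU σ' i) z (v' i)) =
      (∏ i, h.recursionFactor b c i) * ∏ i, hyperFactor (F.extU σ' i) z (v' i) := by
    rw [Finset.prod_mul_distrib, Fintype.prod_sum_type]
    simp
  have hj : h.recursionFactor b c j * hyperFactor (F.extU σ' (Sum.inl j : Fin n ⊕ Fin m)) z
      (v' (Sum.inl j)) = (if Int.fract c = 0 then F.u σ j else 1) *
        (((c : ST N) / F.u σ j) ^ ⌊c⌋₊ / (Nat.factorial ⌊c⌋₊ : ST N)) *
        hyperFactor (F.u σ j + (c : ST N) * z) z (v (Sum.inl j) - c) := by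
    have h1 : F.extU σ' (Sum.inl j : Fin n ⊕ Fin m) = F.u σ j + (c : ST N) * z := by
      rw [hz, extU, Sum.elim_inl, h.u_right hc, (h.curveDegree_spec c).1]
    rw [recursionFactor, if_pos rfl, h1, hv', extDegree_sub_inl, (h.curveDegree_spec c).1]
  have hother : ∏ i ∈ Finset.univ.erase (Sum.inl j : Fin n ⊕ Fin m),
      hyperFactor (F.extU σ i) z (v i) = ∏ i ∈ Finset.univ.erase (Sum.inl j : Fin n ⊕ Fin m),
        (Sum.elim (h.recursionFactor b c) (fun _ => 1) i *
          hyperFactor (F.extU σ' i) z (v' i)) := by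
    refine Finset.prod_congr rfl ?_
    rintro (i | i) hi
    · refine h.hyperFactor_eq_recursionFactor_mul hs hb hc hC ?_
      rintro rfl
      exact absurd rfl (Finset.ne_of_mem_erase hi)
    · rw [Sum.elim_inr, one_mul]
      rfl
  rw [← Finset.mul_prod_erase _ _ (Finset.mem_univ (Sum.inl j : Fin n ⊕ Fin m)), Sum.elim_inl,
    hj] at hprod
  rw [hother, mul_assoc (1 / (c : ST N)), mul_assoc (1 / (c : ST N)), hprod]
  ring

/-- The recursion for the residues of the I-function. -/
theorem residueAt_extIAt_eq (hs : ∀ k, s k ∈ F.suppSet) {b : N} (hb : b ∈ F.boxOf σ)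
    {c : ℚ} (hc : 0 < c) (hcb : Int.fract c = F.coord (F.hat b) j) (d : Fin n → ℚ)
    (k : Fin m →₀ ℕ) (e : Fin n →₀ ℕ) :
    residueAt (-(F.u σ j) / (c : ST N)) (F.extIAt s h.left b d k e) =
      F.recursionCoeff σ σ' j j' b c * valueAt (-(F.u σ j) / (c : ST N))
        (F.extIAt s h.right (b - ∑ i, ⌊F.coord b i + F.curveDegree σ σ' j c i⌋ • F.ρ i)
          (d - F.curveDegree σ σ' j c) k e) := by
  rw [(h.hasValueAt_extIAt_right hs (h.oppositeBox_mem hb hcb) hc _ k e).valueAt_eq]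
  by_cases hC : F.Contributes s σ b d k ∧
      c ≤ F.extDegree s d (fun l => (k l : ℚ)) (Sum.inl j)
  · rw [h.residueAt_extIAt hs hb hc hcb e hC.1 hC.2,
      if_pos (h.contributes_right hs hb hcb hC.1 hC.2)]
  · rw [h.residueAt_extIAt_eq_zero hs hb hc e hC]
    split_ifs with hC'
    -- A degree present only at `σ'` has a negative integer `λ_{j'}`. As `u_{j'}(σ') = l_{j'} z` at
    -- the pole, its factor at `j'` is zero, in agreement with the zero residue.
    · have hneg : F.extDegree s d (fun l => (k l : ℚ)) (Sum.inl j') < 0 :=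
        not_le.1 fun h0 => hC (h.contributes_left hs hb hcb hC' h0)
      have hint : Int.fract (F.extDegree s d (fun l => (k l : ℚ)) (Sum.inl j')) = 0 := by
        rw [h.coord_eq_of_contributes_right hs hb hcb hC' j',
          (coord_of_mem_boxOf h.left.1 hb).2.1 j' h.mem_right.2, neg_zero, zero_add,
          Int.fract_intCast]
      rw [Finset.prod_eq_zero (Finset.mem_univ (Sum.inl j')), mul_zero, mul_zero]
      rw [extDegree_sub_inl, extU, Sum.elim_inl, h.u_right hc, h.left.u_eq_zero h.mem_right.2,
        zero_add]
      exact hyperFactor_eq_zero (h.curveDegree_pos hc).le hneg hint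
    · rw [mul_zero]

end Adjacent

end StackyFan

end ToricStack

theorem mainTheorem4 {N : Type*} [AddCommGroup N] [Module.Finite ℤ N] {n m : ℕ}
    (F : ToricStack.StackyFan N n) (s : Fin m → N) (hs : ∀ k, s k ∈ F.suppSet)
    {σ σ' : Finset (Fin n)} {j j' : Fin n} (h : F.Adjacent σ σ' j j')
    (b : N) (hb : b ∈ F.boxOf σ)
    (c : ℚ) (hc : 0 < c) (hcb : Int.fract c = F.coord (F.hat b) j) :
    (∃! b' : N, F.IsOpposite σ σ' j j' b c b') ∧
    ∀ b' : N, F.IsOpposite σ σ' j j' b c b' →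
      (∀ d k e, ToricStack.RegularAt (-(F.u σ j) / (c : ToricStack.ST N))
        (MvPowerSeries.coeff e (F.extIAt s h.right b' d k))) ∧
      (F.extIAt s h.left b).mapCoeff
          (ToricStack.residueAt (-(F.u σ j) / (c : ToricStack.ST N)))
        = ToricStack.Series.mulQ (F.curveDegree σ σ' j c)
            ((F.extIAt s h.right b').mapCoeff fun f =>
              F.recursionCoeff σ σ' j j' b c *
                ToricStack.valueAt (-(F.u σ j) / (c : ToricStack.ST N)) f) := by
  have hiff := h.isOpposite_iff hb hc hcb
  refine ⟨⟨_, (hiff _).2 rfl, fun b' hb' => (hiff b').1 hb'⟩, fun b' hb' => ⟨?_, ?_⟩⟩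
  · intro d k e
    exact (h.hasValueAt_extIAt_right hs hb'.1 hc d k e).regularAt
  · rw [(hiff b').1 hb']
    funext d k e
    exact h.residueAt_extIAt_eq hs hb hc hcb d k e
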